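/- There is a universal constant $C\in(0,\infty)$ such that, for every finite-dimensional real normed space $(X,\|\cdot\|)$, the $\tfrac12$-snowflake $(X,\|x-y\|^{1/2})$ embeds into the separable Hilbert space $\ell_2$ with quadratic average distortion at most $D=C\sqrt{\log(\dim X+1)}$. That is, for every Borel probability measure $\mu$ on $X$ there exist $\sigma\in(0,\infty)$ and a map $f:X\to\ell_2$ such that $$\|f(x)-f(y)\|_{\ell_2}\le \sigma D\,\|x-y\|^{1/2}\qquad\text{for all }x,y\in X$$ and $$\int_X\int_X\|f(x)-f(y)\|_{\ell_2}^2\,d\mu(x)\,d\mu(y)\ \ge\ \sigma^2\int_X\int_X\|x-y\|\,d\mu(x)\,d\mu(y),$$ where the integrals take values in $[0,\infty]$. -/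

import Mathlib

open MeasureTheory
open scoped ENNReal

/-- The metric space `M` embeds into the metric space `N` with `q`-average distortion at most `D`:
for every Borel probability measure `μ` on `M` there are a scaling factor `σ > 0` and a
`σ D`-Lipschitz map `f : M → N` with
`∬ d_N (f x, f y) ^ q dμ dμ ≥ σ ^ q ∬ d_M (x, y) ^ q dμ dμ`.
The double integrals are integrals of nonnegative functions, with values in `[0, ∞]`. -/
def EmbedsWithAverageDistortion (M : Type*) (N : Type*) [MetricSpace M] [MetricSpace N]
    (q D : ℝ) : Prop :=
  ∀ [MeasurableSpace M] [BorelSpace M] (μ : Measure M) [IsProbabilityMeasure μ],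
    ∃ σ : ℝ, 0 < σ ∧ ∃ f : M → N,
      (∀ x y, dist (f x) (f y) ≤ σ * D * dist x y) ∧
      ENNReal.ofReal σ ^ q * ∫⁻ x, ∫⁻ y, edist x y ^ q ∂μ ∂μ
        ≤ ∫⁻ x, ∫⁻ y, edist (f x) (f y) ^ q ∂μ ∂μ

/-- The `1/2`-snowflake of a metric space: the same points with the metric `d ^ (1/2)`. -/
abbrev HalfSnowflake (X : Type*) : Type _ :=
  Metric.Snowflaking X (1 / 2 : ℝ) (by norm_num) (by norm_num)

/-- The separable real Hilbert space `ℓ₂` of square-summable sequences. -/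
abbrev EllTwo : Type := lp (fun _ : ℕ => ℝ) 2

/-! Let `n` be the dimension of `X`. For finitely supported `μ` with weights `m`, Hahn–Banach
separation applied to the convex cone of squared Euclidean distance matrices
(`exists_euclidean_of_duality`) reduces the embedding to a Poincaré inequality: if nonnegative
weights `w` satisfy `∑ m m |g - g|² ≤ ∑ w |g - g|²` for all real `g`, then `∑ m m ‖x - x‖ ≤ O(log n)
∑ w ‖x - x‖` for all `x` with values in `X` (`linear_poincare`).

To prove this, discretize the random walk of `w` with a small time step `ε`; it contracts the
variance by `1 - ε`. After `k ≈ log n / ε` steps the contraction beats the factor `n²` lost by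
comparing the norm of `X` with a Euclidean one, so the `k`-step chain satisfies a quadratic Poincaré
inequality in `X` with an absolute constant (`IsContractiveChain.sum_norm_sq_le`). That inequality
is applied to the radial images `v / √‖v‖` of the points. Since the radial map is 1/2-Hölder, the
right side becomes a sum of first powers of distances, for which the triangle inequality bounds `k`
steps by `k` times one step. One step costs `ε ∑ w ‖x - x‖`, and `k ε = O(log n)`. The inverse of
the radial map brings the left side back to first powers (`sum_mul_mul_norm_sub_le_of_radialSqrt`).

The map must be Hölder on all of `X`, not only on the support of `μ`. Duality is therefore applied
on every finite set containing the support, the target dimension is bounded by projection, and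
compactness gives a global map. A general `μ` of finite first moment is approximated by finitely
supported measures; if the first moment is infinite, `√‖x‖` in a single coordinate suffices. -/

/-! ### The radial map between a normed space and its 1/2-snowflake. -/

section RadialMap

variable {X : Type*} [NormedAddCommGroup X] [NormedSpace ℝ X]

/-- The radial map `v ↦ v / √‖v‖`. -/
noncomputable def radialSqrt (v : X) : X := (Real.sqrt ‖v‖)⁻¹ • v

theorem norm_radialSqrt (v : X) : ‖radialSqrt v‖ = Real.sqrt ‖v‖ := by
  unfold radialSqrt
  rw [norm_smul, norm_inv, Real.norm_of_nonneg (Real.sqrt_nonneg _), inv_mul_eq_div,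
    Real.div_sqrt]

theorem norm_radialSqrt_sq (v : X) : ‖radialSqrt v‖ ^ 2 = ‖v‖ := by
  rw [norm_radialSqrt, Real.sq_sqrt (norm_nonneg _)]

theorem norm_smul_radialSqrt (v : X) : ‖radialSqrt v‖ • radialSqrt v = v := by
  rw [norm_radialSqrt, radialSqrt, smul_smul]
  rcases eq_or_ne v 0 with rfl | hv
  · simp
  · rw [mul_inv_cancel₀ (Real.sqrt_ne_zero'.2 (norm_pos_iff.2 hv)), one_smul]

/-- With `a = √‖u‖ ≥ b = √‖v‖` and `d = ‖u - v‖`, rescaling by `a` gives `a ‖radialSqrt u -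
radialSqrt v‖ ≤ d + (a - b) b ≤ 2 d`. Square this and use `d ≤ 2 a²` once. -/
theorem norm_radialSqrt_sub_sq_le (u v : X) :
    ‖radialSqrt u - radialSqrt v‖ ^ 2 ≤ 8 * ‖u - v‖ := by
  wlog h : ‖v‖ ≤ ‖u‖ generalizing u v
  · rw [norm_sub_rev, norm_sub_rev u v]
    exact this v u (le_of_not_ge h)
  rcases eq_or_ne u 0 with rfl | hu
  · have : v = 0 := by simpa using h
    simp [this]
  have ha : 0 < Real.sqrt ‖u‖ := Real.sqrt_pos.2 (norm_pos_iff.2 hu)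
  set a := Real.sqrt ‖u‖ with ha_def
  set b := Real.sqrt ‖v‖ with hb_def
  have hb : 0 ≤ b := Real.sqrt_nonneg _
  have hua : ‖u‖ = a ^ 2 := (Real.sq_sqrt (norm_nonneg _)).symm
  have hvb : ‖v‖ = b ^ 2 := (Real.sq_sqrt (norm_nonneg _)).symm
  have hba : b ≤ a := Real.sqrt_le_sqrt h
  set d := ‖u - v‖ with hd
  have hd1 : a ^ 2 - b ^ 2 ≤ d := by
    rw [← hua, ← hvb]; exact norm_sub_norm_le u v
  have hd2 : d ≤ a ^ 2 + b ^ 2 := by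
    rw [← hua, ← hvb]; exact norm_sub_le u v
  have key : a * ‖radialSqrt u - radialSqrt v‖ ≤ 2 * d := by
    have e : a • (radialSqrt u - radialSqrt v) = (u - v) + (v - a • radialSqrt v) := by
      have : a • radialSqrt u = u := by
        have := norm_smul_radialSqrt u
        rwa [norm_radialSqrt] at this
      rw [smul_sub, this]; abel
    have e2 : v - a • radialSqrt v = (b - a) • radialSqrt v := by
      have : b • radialSqrt v = v := by
        have := norm_smul_radialSqrt v
        rwa [norm_radialSqrt] at this
      rw [sub_smul, this]
    have e3 : ‖v - a • radialSqrt v‖ = (a - b) * b := by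
      rw [e2, norm_smul, norm_radialSqrt, Real.norm_eq_abs, abs_sub_comm,
        abs_of_nonneg (sub_nonneg.2 hba)]
    calc a * ‖radialSqrt u - radialSqrt v‖ = ‖a • (radialSqrt u - radialSqrt v)‖ := by
          rw [norm_smul, Real.norm_of_nonneg ha.le]
      _ ≤ d + (a - b) * b := by rw [e, ← e3]; exact norm_add_le _ _
      _ ≤ 2 * d := by nlinarith
  have h0 : 0 ≤ ‖radialSqrt u - radialSqrt v‖ := norm_nonneg _
  have hd0 : 0 ≤ d := norm_nonneg _
  have k2 : (a * ‖radialSqrt u - radialSqrt v‖) ^ 2 ≤ (2 * d) ^ 2 :=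
    pow_le_pow_left₀ (by positivity) key 2
  have k3 : a ^ 2 * ‖radialSqrt u - radialSqrt v‖ ^ 2 ≤ a ^ 2 * (8 * d) := by
    have hb2 : b ^ 2 ≤ a ^ 2 := pow_le_pow_left₀ hb hba 2
    nlinarith
  exact le_of_mul_le_mul_left k3 (by positivity)

/-- The map `p ↦ ‖p‖ • p` inverts `radialSqrt`. This local Lipschitz bound lets Cauchy–Schwarz turn
quadratic information on radial images into a bound on distances. -/
theorem norm_norm_smul_sub_norm_smul_le (p q : X) :
    ‖‖p‖ • p - ‖q‖ • q‖ ≤ ‖p - q‖ * (‖p‖ + ‖q‖) := by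
  have e : ‖p‖ • p - ‖q‖ • q = ‖p‖ • (p - q) + (‖p‖ - ‖q‖) • q := by
    rw [smul_sub, sub_smul]; abel
  have h := abs_norm_sub_norm_le p q
  calc ‖‖p‖ • p - ‖q‖ • q‖ ≤ ‖p‖ * ‖p - q‖ + |‖p‖ - ‖q‖| * ‖q‖ := by
        rw [e]
        refine (norm_add_le _ _).trans ?_
        rw [norm_smul, norm_smul, norm_norm, Real.norm_eq_abs]
    _ ≤ ‖p‖ * ‖p - q‖ + ‖p - q‖ * ‖q‖ := by gcongr
    _ = _ := by ring

end RadialMap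

/-! ### Comparison with a Euclidean norm. -/

/-- A normed space of dimension `n` has an Auerbach basis. -/
theorem exists_auerbach_basis (X : Type*) [NormedAddCommGroup X] [NormedSpace ℝ X]
    [FiniteDimensional ℝ X] :
    ∃ b : Module.Basis (Fin (Module.finrank ℝ X)) ℝ X,
      (∀ k, ‖b k‖ ≤ 1) ∧ ∀ k v, |b.coord k v| ≤ ‖v‖ := by
  let n := Module.finrank ℝ X
  let e : Module.Basis (Fin n) ℝ X := Module.finBasis ℝ X
  have hK : IsCompact (Set.univ.pi fun _ : Fin n => Metric.closedBall (0 : X) 1) :=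
    isCompact_univ_pi fun _ => isCompact_closedBall _ _
  have hcont : Continuous fun v : Fin n → X => |e.det v| := by
    have : Continuous fun v : Fin n → X => e.det v := by
      simp only [Module.Basis.det_apply]
      refine Continuous.matrix_det (continuous_matrix fun i j => ?_)
      simp only [Module.Basis.toMatrix_apply]
      exact (LinearMap.continuous_of_finiteDimensional (e.coord i)).comp (continuous_apply j)
    exact this.abs
  -- Maximize the volume over tuples in the unit ball. Replacing `v k` by a unit vector multiplies
  -- the determinant by its `k`-th coordinate, which hence has absolute value at most 1.
  obtain ⟨v, hv, hmax⟩ := hK.exists_isMaxOn ⟨0, by simp⟩ hcont.continuousOn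
  have hv1 : ∀ k, ‖v k‖ ≤ 1 := fun k => by simpa using hv k (Set.mem_univ k)
  have hpos : 0 < |e.det v| := by
    let w : Fin n → X := fun k => ‖e k‖⁻¹ • e k
    have hw : w ∈ Set.univ.pi fun _ : Fin n => Metric.closedBall (0 : X) 1 := fun k _ => by
      simp [w, norm_smul, inv_mul_cancel₀ (norm_ne_zero_iff.2 (e.ne_zero k))]
    refine lt_of_lt_of_le ?_ (hmax hw)
    have : e.det w = ∏ k, ‖e k‖⁻¹ := by
      have := e.det.map_smul_univ (fun k => ‖e k‖⁻¹) e
      simpa [w, e.det_self] using this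
    change 0 < |e.det w|
    rw [this, abs_pos]
    exact Finset.prod_ne_zero_iff.2 fun k _ => inv_ne_zero (norm_ne_zero_iff.2 (e.ne_zero k))
  have hb : LinearIndependent ℝ v ∧ Submodule.span ℝ (Set.range v) = ⊤ :=
    (e.is_basis_iff_det).2 (isUnit_iff_ne_zero.2 (abs_pos.1 hpos))
  refine ⟨Module.Basis.mk hb.1 hb.2.ge, fun k => by simpa using hv1 k, fun k y => ?_⟩
  have key : ∀ z : X, ‖z‖ ≤ 1 → |(Module.Basis.mk hb.1 hb.2.ge).coord k z| ≤ 1 := by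
    intro z hz
    have h1 := e.det_smul_mk_coord_eq_det_update hb.1 hb.2.ge k
    have h2 : e.det v * (Module.Basis.mk hb.1 hb.2.ge).coord k z
        = e.det (Function.update v k z) := by
      have := LinearMap.congr_fun h1 z
      simpa using this
    have h3 : |e.det (Function.update v k z)| ≤ |e.det v| := by
      refine hmax fun j _ => ?_
      rcases eq_or_ne j k with rfl | hj
      · simpa using hz
      · simpa [hj] using hv1 j
    rw [← h2, abs_mul] at h3
    exact le_of_mul_le_mul_left (by simpa using h3) hpos
  rcases eq_or_ne y 0 with rfl | hy
  · rw [map_zero, abs_zero, norm_zero]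
  have hy' := norm_pos_iff.2 hy
  have := key (‖y‖⁻¹ • y) (by simp [norm_smul, inv_mul_cancel₀ hy'.ne'])
  rw [map_smul, smul_eq_mul, abs_mul, abs_of_pos (inv_pos.2 hy'), inv_mul_le_iff₀ hy'] at this
  simpa using this

/-- A normed space of dimension `n` is Euclidean up to the factor `n`. -/
theorem exists_linear_coordinates (X : Type*) [NormedAddCommGroup X] [NormedSpace ℝ X]
    [FiniteDimensional ℝ X] :
    ∃ c : Fin (Module.finrank ℝ X) → X →ₗ[ℝ] ℝ,
      (∀ v, ∑ k, (c k v) ^ 2 ≤ Module.finrank ℝ X * ‖v‖ ^ 2) ∧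
      ∀ v, ‖v‖ ^ 2 ≤ Module.finrank ℝ X * ∑ k, (c k v) ^ 2 := by
  obtain ⟨b, hb1, hb2⟩ := exists_auerbach_basis X
  refine ⟨b.coord, fun v => ?_, fun v => ?_⟩
  · calc ∑ k, (b.coord k v) ^ 2 ≤ ∑ _k : Fin (Module.finrank ℝ X), ‖v‖ ^ 2 :=
          Finset.sum_le_sum fun k _ => by
            rw [← sq_abs]
            exact pow_le_pow_left₀ (abs_nonneg _) (hb2 k v) 2
      _ = _ := by simp
  · have h1 : ‖v‖ ≤ ∑ k, |b.coord k v| := by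
      conv_lhs => rw [← b.sum_repr v]
      refine (norm_sum_le _ _).trans (Finset.sum_le_sum fun k _ => ?_)
      rw [norm_smul, Real.norm_eq_abs]
      exact mul_le_of_le_one_right (abs_nonneg _) (hb1 k)
    calc ‖v‖ ^ 2 ≤ (∑ k, |b.coord k v|) ^ 2 := pow_le_pow_left₀ (norm_nonneg _) h1 2
      _ ≤ _ := by
        have := sq_sum_le_card_mul_sum_sq (s := Finset.univ) (f := fun k => |b.coord k v|)
        simpa using this

/-! ### Contractive Markov chains and their powers. -/

section MarkovChain

variable {V : Type*} [Fintype V]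

/-- A stochastic matrix with stationary measure `m` which contracts, by the factor `ρ`, the squared
`L₂(m)` norm of functions of mean zero. -/
structure IsContractiveChain (m : V → ℝ) (ρ : ℝ) (P : Matrix V V ℝ) : Prop where
  nonneg : ∀ i j, 0 ≤ P i j
  row_sum : ∀ i, ∑ j, P i j = 1
  stationary : ∀ j, ∑ i, m i * P i j = m j
  contract : ∀ g : V → ℝ, ∑ i, m i * g i = 0 →
    ∑ i, m i * (∑ j, P i j * g j) ^ 2 ≤ ρ * ∑ i, m i * g i ^ 2

namespace IsContractiveChain

variable {m : V → ℝ} {ρ : ℝ} {P : Matrix V V ℝ}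

theorem sum_mul_sum (h : IsContractiveChain m ρ P) (g : V → ℝ) :
    ∑ i, m i * ∑ j, P i j * g j = ∑ j, m j * g j := by
  simp_rw [Finset.mul_sum]
  rw [Finset.sum_comm]
  refine Finset.sum_congr rfl fun j _ => ?_
  rw [← h.stationary j, Finset.sum_mul]
  exact Finset.sum_congr rfl fun i _ => by ring

theorem pow [DecidableEq V] (h : IsContractiveChain m ρ P) (hρ : 0 ≤ ρ) (k : ℕ) :
    IsContractiveChain m (ρ ^ k) (P ^ k) := by
  induction k with
  | zero =>
    refine ⟨fun i j => ?_, fun i => ?_, fun j => ?_, fun g _ => ?_⟩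
    · rw [pow_zero, Matrix.one_apply]; split_ifs <;> norm_num
    · simp [Matrix.one_apply]
    · simp [Matrix.one_apply]
    · simp [Matrix.one_apply]
  | succ k ih =>
    have hmul : ∀ (g : V → ℝ) i, ∑ j, (P ^ (k + 1)) i j * g j
        = ∑ l, (P ^ k) i l * ∑ j, P l j * g j := by
      intro g i
      simp_rw [pow_succ, Matrix.mul_apply, Finset.sum_mul, Finset.mul_sum]
      rw [Finset.sum_comm]
      exact Finset.sum_congr rfl fun l _ => Finset.sum_congr rfl fun j _ => by ring
    refine ⟨fun i j => ?_, fun i => ?_, fun j => ?_, fun g hg => ?_⟩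
    · rw [pow_succ, Matrix.mul_apply]
      exact Finset.sum_nonneg fun l _ => mul_nonneg (ih.nonneg i l) (h.nonneg l j)
    · have := hmul (fun _ => 1) i
      simpa [h.row_sum, ih.row_sum] using this
    · simp_rw [pow_succ, Matrix.mul_apply]
      rw [ih.sum_mul_sum fun l => P l j]
      exact h.stationary j
    · simp_rw [hmul]
      refine (ih.contract _ ((h.sum_mul_sum g).trans hg)).trans ?_
      rw [pow_succ, mul_assoc]
      exact mul_le_mul_of_nonneg_left (h.contract g hg) (pow_nonneg hρ k)

/-- Triangle inequality along a trajectory of the chain: by stationarity each of the `k` steps has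
the same expected length. -/
theorem sum_pow_mul_dist_le [DecidableEq V] {X : Type*} [PseudoMetricSpace X]
    (h : IsContractiveChain m ρ P) (hρ : 0 ≤ ρ) (hm : ∀ i, 0 ≤ m i) (x : V → X) (k : ℕ) :
    ∑ i, m i * ∑ j, (P ^ k) i j * dist (x i) (x j)
      ≤ k * ∑ i, m i * ∑ j, P i j * dist (x i) (x j) := by
  induction k with
  | zero => simp [Matrix.one_apply]
  | succ k ih =>
    have hk := h.pow hρ k
    have h1 : ∀ i, ∑ j, (P ^ (k + 1)) i j * dist (x i) (x j)
        ≤ ∑ l, (P ^ k) i l * dist (x i) (x l)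
          + ∑ l, (P ^ k) i l * ∑ j, P l j * dist (x l) (x j) := by
      intro i
      have e : ∑ j, (P ^ (k + 1)) i j * dist (x i) (x j)
          = ∑ l, (P ^ k) i l * ∑ j, P l j * dist (x i) (x j) := by
        simp_rw [pow_succ, Matrix.mul_apply, Finset.sum_mul, Finset.mul_sum]
        rw [Finset.sum_comm]
        exact Finset.sum_congr rfl fun l _ => Finset.sum_congr rfl fun j _ => by ring
      rw [e, ← Finset.sum_add_distrib]
      refine Finset.sum_le_sum fun l _ => ?_
      rw [← mul_add]
      refine mul_le_mul_of_nonneg_left ?_ (hk.nonneg i l)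
      calc ∑ j, P l j * dist (x i) (x j)
          ≤ ∑ j, (P l j * dist (x i) (x l) + P l j * dist (x l) (x j)) :=
            Finset.sum_le_sum fun j _ => by
              rw [← mul_add]
              exact mul_le_mul_of_nonneg_left (dist_triangle _ _ _) (h.nonneg l j)
        _ = _ := by rw [Finset.sum_add_distrib, ← Finset.sum_mul, h.row_sum, one_mul]
    calc ∑ i, m i * ∑ j, (P ^ (k + 1)) i j * dist (x i) (x j)
        ≤ ∑ i, (m i * ∑ l, (P ^ k) i l * dist (x i) (x l)
          + m i * ∑ l, (P ^ k) i l * ∑ j, P l j * dist (x l) (x j)) :=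
          Finset.sum_le_sum fun i _ => by
            rw [← mul_add]
            exact mul_le_mul_of_nonneg_left (h1 i) (hm i)
      _ ≤ _ := by
          rw [Finset.sum_add_distrib, hk.sum_mul_sum fun l => ∑ j, P l j * dist (x l) (x j)]
          push_cast
          linarith

/-- A vector-valued Poincaré inequality for strongly contractive chains. -/
theorem sum_norm_sq_le {X : Type*} [NormedAddCommGroup X] [NormedSpace ℝ X]
    [FiniteDimensional ℝ X] (h : IsContractiveChain m ρ P) (hρ0 : 0 ≤ ρ) (hm : ∀ i, 0 ≤ m i)
    (hρ : (Module.finrank ℝ X : ℝ) ^ 2 * ρ ≤ 1 / 4) (f : V → X) (hf : ∑ i, m i • f i = 0) :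
    ∑ i, m i * ‖f i‖ ^ 2 ≤ 4 * ∑ i, m i * ∑ j, P i j * ‖f i - f j‖ ^ 2 := by
  obtain ⟨c, hc1, hc2⟩ := exists_linear_coordinates X
  set n : ℝ := ((Module.finrank ℝ X : ℕ) : ℝ) with hn
  have hn0 : 0 ≤ n := Nat.cast_nonneg _
  set S := ∑ i, m i * ‖f i‖ ^ 2 with hS
  have hS0 : 0 ≤ S := Finset.sum_nonneg fun i _ => mul_nonneg (hm i) (sq_nonneg _)
  -- Contract each linear coordinate separately; going to coordinates and back costs `n` each time,
  -- and `hρ` absorbs the resulting `n²`.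
  have hQ : ∑ i, m i * ‖∑ j, P i j • f j‖ ^ 2 ≤ S / 4 := by
    have step : ∀ k, ∑ i, m i * (c k (∑ j, P i j • f j)) ^ 2 ≤ ρ * ∑ i, m i * (c k (f i)) ^ 2 := by
      intro k
      have := h.contract (fun i => c k (f i)) (by
        have := congrArg (c k) hf
        simpa using this)
      simpa using this
    calc ∑ i, m i * ‖∑ j, P i j • f j‖ ^ 2
          ≤ ∑ i, m i * (n * ∑ k, (c k (∑ j, P i j • f j)) ^ 2) :=
            Finset.sum_le_sum fun i _ => mul_le_mul_of_nonneg_left (hc2 _) (hm i)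
        _ = n * ∑ k, ∑ i, m i * (c k (∑ j, P i j • f j)) ^ 2 := by
            rw [Finset.sum_comm, Finset.mul_sum]
            refine Finset.sum_congr rfl fun i _ => ?_
            rw [← Finset.mul_sum]; ring
        _ ≤ n * ∑ k, ρ * ∑ i, m i * (c k (f i)) ^ 2 :=
            mul_le_mul_of_nonneg_left (Finset.sum_le_sum fun k _ => step k) hn0
        _ = n * ρ * ∑ i, m i * ∑ k, (c k (f i)) ^ 2 := by
            rw [← Finset.mul_sum, Finset.sum_comm, ← mul_assoc]
            simp_rw [Finset.mul_sum]
        _ ≤ n * ρ * ∑ i, m i * (n * ‖f i‖ ^ 2) :=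
            mul_le_mul_of_nonneg_left
              (Finset.sum_le_sum fun i _ => mul_le_mul_of_nonneg_left (hc1 _) (hm i))
              (mul_nonneg hn0 hρ0)
        _ = n ^ 2 * ρ * S := by
            rw [hS, Finset.mul_sum, Finset.mul_sum]
            exact Finset.sum_congr rfl fun i _ => by ring
        _ ≤ S / 4 := by nlinarith
  -- Split `f i` into its mean increment and its average under `P`. The averages contribute at most
  -- `S / 2` in total, which is moved to the left side.
  have hpt : ∀ i, ‖f i‖ ^ 2
      ≤ 2 * ∑ j, P i j * ‖f i - f j‖ ^ 2 + 2 * ‖∑ j, P i j • f j‖ ^ 2 := by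
    intro i
    have e : f i = ∑ j, P i j • (f i - f j) + ∑ j, P i j • f j := by
      simp_rw [smul_sub]
      rw [Finset.sum_sub_distrib, ← Finset.sum_smul, h.row_sum, one_smul, sub_add_cancel]
    have h1 : ‖∑ j, P i j • (f i - f j)‖ ≤ ∑ j, P i j * ‖f i - f j‖ := by
      refine (norm_sum_le _ _).trans (Finset.sum_le_sum fun j _ => ?_)
      rw [norm_smul, Real.norm_of_nonneg (h.nonneg i j)]
    have h2 : (∑ j, P i j * ‖f i - f j‖) ^ 2 ≤ ∑ j, P i j * ‖f i - f j‖ ^ 2 :=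
      Real.pow_arith_mean_le_arith_mean_pow _ _ _ (fun j _ => h.nonneg i j) (h.row_sum i)
        (fun j _ => norm_nonneg _) 2
    have h3 : ‖f i‖ ≤ ∑ j, P i j * ‖f i - f j‖ + ‖∑ j, P i j • f j‖ := by
      conv_lhs => rw [e]
      exact (norm_add_le _ _).trans (by gcongr)
    have h4 := pow_le_pow_left₀ (norm_nonneg _) h3 2
    nlinarith [sq_nonneg (∑ j, P i j * ‖f i - f j‖ - ‖∑ j, P i j • f j‖)]
  have : S ≤ 2 * ∑ i, m i * ∑ j, P i j * ‖f i - f j‖ ^ 2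
      + 2 * ∑ i, m i * ‖∑ j, P i j • f j‖ ^ 2 := by
    rw [Finset.mul_sum, Finset.mul_sum, ← Finset.sum_add_distrib]
    refine Finset.sum_le_sum fun i _ => ?_
    nlinarith [mul_le_mul_of_nonneg_left (hpt i) (hm i)]
  linarith

end IsContractiveChain

end MarkovChain

/-! ### From a scalar spectral gap to Poincaré inequalities in `X`. -/

section SpectralGap

variable {V : Type*} [Fintype V]

theorem sum_mul_mul_sub_sq {m g : V → ℝ} (hm1 : ∑ i, m i = 1) (hg : ∑ i, m i * g i = 0) :
    ∑ i, ∑ j, m i * m j * (g i - g j) ^ 2 = 2 * ∑ i, m i * g i ^ 2 := by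
  have e : ∀ i, ∑ j, m i * m j * (g i - g j) ^ 2
      = m i * g i ^ 2 - 2 * (m i * g i) * 0 + m i * ∑ j, m j * g j ^ 2 := by
    intro i
    rw [← hg]
    conv_rhs => rw [← mul_one (m i * g i ^ 2), ← hm1]
    rw [Finset.mul_sum, Finset.mul_sum, Finset.mul_sum, ← Finset.sum_sub_distrib,
      ← Finset.sum_add_distrib]
    exact Finset.sum_congr rfl fun j _ => by ring
  simp_rw [e]
  rw [Finset.sum_add_distrib, ← Finset.sum_mul, hm1]
  simp
  ring

theorem sum_mul_laplacian {w : V → V → ℝ} (hsymm : ∀ i j, w i j = w j i) (g : V → ℝ) :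
    2 * ∑ i, g i * ∑ j, w i j * (g i - g j) = ∑ i, ∑ j, w i j * (g i - g j) ^ 2 := by
  have h2 : ∑ i, g i * ∑ j, w i j * (g i - g j) = ∑ i, ∑ j, g j * (w i j * (g j - g i)) := by
    simp_rw [Finset.mul_sum]
    rw [Finset.sum_comm]
    exact Finset.sum_congr rfl fun i _ => Finset.sum_congr rfl fun j _ => by rw [hsymm]
  rw [two_mul]
  nth_rewrite 2 [h2]
  simp_rw [Finset.mul_sum]
  simp_rw [← Finset.sum_add_distrib]
  exact Finset.sum_congr rfl fun i _ => Finset.sum_congr rfl fun j _ => by ring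

/-- The discretized random walk of a weighted graph with spectral gap at least `1`. -/
theorem exists_isContractiveChain {m : V → ℝ} {w : V → V → ℝ} (hm : ∀ i, 0 < m i)
    (hm1 : ∑ i, m i = 1) (hw : ∀ i j, 0 ≤ w i j) (hsymm : ∀ i j, w i j = w j i)
    (hgap : ∀ g : V → ℝ, ∑ i, ∑ j, m i * m j * (g i - g j) ^ 2
      ≤ ∑ i, ∑ j, w i j * (g i - g j) ^ 2) :
    ∃ ε : ℝ, 0 < ε ∧ ε ≤ 1 ∧ ∃ P : Matrix V V ℝ, IsContractiveChain m (1 - ε) P ∧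
      ∀ i j, i ≠ j → m i * P i j = ε * w i j := by
  classical
  have hne : Nonempty V := by
    by_contra h
    rw [not_nonempty_iff] at h
    simp at hm1
  obtain ⟨i₀, hi₀⟩ := Finite.exists_min m
  set W : V → ℝ := fun i => ∑ j, w i j with hW
  have hW0 : ∀ i, 0 ≤ W i := fun i => Finset.sum_nonneg fun j _ => hw i j
  set T := ∑ i, W i with hT
  have hT0 : 0 ≤ T := Finset.sum_nonneg fun i _ => hW0 i
  have hWT : ∀ i, W i ≤ T := fun i =>
    Finset.single_le_sum (f := W) (fun j _ => hW0 j) (Finset.mem_univ i)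
  -- The time step is small enough that `2 ε W i ≤ m i`: the chain is then nonnegative on the
  -- diagonal, and the second-order term below is at most half of the first-order gain.
  set ε := m i₀ / (2 * T + 1) with hε
  have hε0 : 0 < ε := div_pos (hm i₀) (by linarith)
  have hεT : ε * (2 * T + 1) = m i₀ := div_mul_cancel₀ _ (by linarith)
  have hm01 : m i₀ ≤ 1 := by
    rw [← hm1]
    exact Finset.single_le_sum (f := m) (fun j _ => (hm j).le) (Finset.mem_univ i₀)
  have hε1 : ε ≤ 1 := by nlinarith
  have hεW : ∀ i, 2 * ε * W i ≤ m i := by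
    intro i
    have := hi₀ i
    have := hWT i
    nlinarith
  -- The matrix is `1 - ε M⁻¹ Δ`, where `M` is the diagonal matrix of `m` and `Δ` the Laplacian of
  -- `w`.
  refine ⟨ε, hε0, hε1, fun i j => (if i = j then 1 - ε * W i / m i else 0) + ε * w i j / m i,
    ?_, ?_⟩
  swap
  · intro i j hij
    change m i * ((if i = j then 1 - ε * W i / m i else 0) + ε * w i j / m i) = ε * w i j
    rw [if_neg hij, zero_add, mul_div_cancel₀ _ (hm i).ne']
  have hact : ∀ (g : V → ℝ) i,
      ∑ j, ((if i = j then 1 - ε * W i / m i else 0) + ε * w i j / m i) * g j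
        = g i - ε / m i * ∑ j, w i j * (g i - g j) := by
    intro g i
    simp_rw [add_mul, mul_sub]
    rw [Finset.sum_add_distrib, Finset.sum_sub_distrib, ← Finset.sum_mul]
    simp only [ite_mul, zero_mul, Finset.sum_ite_eq, Finset.mem_univ, if_true]
    have : ∑ j, ε * w i j / m i * g j = ε / m i * ∑ j, w i j * g j := by
      rw [Finset.mul_sum]
      exact Finset.sum_congr rfl fun j _ => by ring
    rw [this]
    change _ = g i - ε / m i * (W i * g i - _)
    ring
  refine ⟨fun i j => ?_, fun i => ?_, fun j => ?_, fun g hg => ?_⟩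
  · have h1 : 0 ≤ ε * w i j / m i := div_nonneg (mul_nonneg hε0.le (hw i j)) (hm i).le
    have h2 : ε * W i / m i ≤ 1 := by
      rw [div_le_one (hm i)]
      nlinarith [hεW i, mul_nonneg hε0.le (hW0 i)]
    change 0 ≤ (if i = j then 1 - ε * W i / m i else 0) + ε * w i j / m i
    split_ifs <;> linarith
  · simpa using hact (fun _ => 1) i
  · have e : ∀ i, m i * ((if i = j then 1 - ε * W i / m i else 0) + ε * w i j / m i)
        = (if i = j then m j - ε * W j else 0) + ε * w j i := by
      intro i
      rw [hsymm j i]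
      have := (hm i).ne'
      split_ifs with h
      · subst h; field_simp
      · field_simp; ring
    simp_rw [e]
    rw [Finset.sum_add_distrib, ← Finset.mul_sum]
    simp [hW]
  · simp_rw [hact]
    set E := ∑ i, ∑ j, w i j * (g i - g j) ^ 2 with hE
    set D : V → ℝ := fun i => ∑ j, w i j * (g i - g j) with hD
    have hsum : 2 * ∑ i, g i * D i = E := sum_mul_laplacian hsymm g
    have hgapg : 2 * ∑ i, m i * g i ^ 2 ≤ E := by
      rw [← sum_mul_mul_sub_sq hm1 hg]; exact hgap g
    have hpt : ∀ i, m i * (g i - ε / m i * D i) ^ 2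
        ≤ m i * g i ^ 2 - 2 * ε * (g i * D i) + ε / 2 * ∑ j, w i j * (g i - g j) ^ 2 := by
      intro i
      have hcs : D i ^ 2 ≤ W i * ∑ j, w i j * (g i - g j) ^ 2 :=
        Finset.sum_sq_le_sum_mul_sum_of_sq_le_mul _ (fun j _ => hw i j)
          (fun j _ => mul_nonneg (hw i j) (sq_nonneg _)) fun j _ => le_of_eq (by ring)
      have hS0 : 0 ≤ ∑ j, w i j * (g i - g j) ^ 2 :=
        Finset.sum_nonneg fun j _ => mul_nonneg (hw i j) (sq_nonneg _)
      have e : m i * (g i - ε / m i * D i) ^ 2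
          = m i * g i ^ 2 - 2 * ε * (g i * D i) + ε * (ε * D i ^ 2 / m i) := by
        have := (hm i).ne'
        field_simp
        ring
      have h3 : ε * D i ^ 2 / m i ≤ 1 / 2 * ∑ j, w i j * (g i - g j) ^ 2 := by
        rw [div_le_iff₀ (hm i)]
        nlinarith [mul_le_mul_of_nonneg_left hcs hε0.le, mul_le_mul_of_nonneg_right (hεW i) hS0]
      rw [e]
      nlinarith
    calc ∑ i, m i * (g i - ε / m i * D i) ^ 2
        ≤ ∑ i, (m i * g i ^ 2 - 2 * ε * (g i * D i)
            + ε / 2 * ∑ j, w i j * (g i - g j) ^ 2) := Finset.sum_le_sum fun i _ => hpt i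
      _ = ∑ i, m i * g i ^ 2 - ε * (2 * ∑ i, g i * D i) + ε / 2 * E := by
          rw [Finset.sum_add_distrib, Finset.sum_sub_distrib, ← Finset.mul_sum, ← Finset.mul_sum]
          ring
      _ ≤ (1 - ε) * ∑ i, m i * g i ^ 2 := by
          rw [hsum]; nlinarith

theorem sum_mul_mul_dist_le {X : Type*} [SeminormedAddCommGroup X] {m : V → ℝ}
    (hm : ∀ i, 0 ≤ m i) (hm1 : ∑ i, m i = 1) (x : V → X) (c : X) :
    ∑ i, ∑ j, m i * m j * ‖x i - x j‖ ≤ 2 * ∑ i, m i * ‖x i - c‖ := by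
  calc ∑ i, ∑ j, m i * m j * ‖x i - x j‖
      ≤ ∑ i, ∑ j, (m j * (m i * ‖x i - c‖) + m i * (m j * ‖x j - c‖)) := by
        refine Finset.sum_le_sum fun i _ => Finset.sum_le_sum fun j _ => ?_
        have h : ‖x i - x j‖ ≤ ‖x i - c‖ + ‖x j - c‖ := by
          rw [norm_sub_rev (x j) c]; exact norm_sub_le_norm_sub_add_norm_sub _ _ _
        nlinarith [mul_le_mul_of_nonneg_left h (mul_nonneg (hm i) (hm j))]
    _ = _ := by
        simp_rw [Finset.sum_add_distrib, ← Finset.mul_sum, ← Finset.sum_mul, hm1]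
        rw [← Finset.mul_sum, two_mul, one_mul]

/-- Some `x j` serves as center, because the right side is the `m`-average over `j` of the left side
at `c = x j`. -/
theorem exists_sum_dist_le {X : Type*} [SeminormedAddCommGroup X] {m : V → ℝ}
    (hm : ∀ i, 0 ≤ m i) (hm1 : ∑ i, m i = 1) (x : V → X) :
    ∃ c : X, ∑ i, m i * ‖x i - c‖ ≤ ∑ i, ∑ j, m i * m j * ‖x i - x j‖ := by
  by_contra! h
  have hj : ∀ j, m j * (∑ i, ∑ j, m i * m j * ‖x i - x j‖) ≤ m j * ∑ i, m i * ‖x i - x j‖ :=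
    fun j => mul_le_mul_of_nonneg_left (h (x j)).le (hm j)
  obtain ⟨j₀, hj₀⟩ : ∃ j, 0 < m j := by
    by_contra! h0
    have : ∑ i, m i ≤ 0 := Finset.sum_nonpos fun i _ => h0 i
    linarith
  have hlt := Finset.sum_lt_sum (fun j _ => hj j)
    ⟨j₀, Finset.mem_univ _, mul_lt_mul_of_pos_left (h (x j₀)) hj₀⟩
  rw [← Finset.sum_mul, hm1, one_mul] at hlt
  refine lt_irrefl _ (hlt.trans_eq ?_)
  simp_rw [Finset.mul_sum]
  rw [Finset.sum_comm]
  exact Finset.sum_congr rfl fun i _ => Finset.sum_congr rfl fun j _ => by ring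

/-- Passing from quadratic to linear Poincaré inequalities, through the radial map. -/
theorem sum_mul_mul_norm_sub_le_of_radialSqrt {X : Type*} [NormedAddCommGroup X] [NormedSpace ℝ X]
    {m : V → ℝ} (hm : ∀ i, 0 ≤ m i) (hm1 : ∑ i, m i = 1) (x : V → X) {K : ℝ}
    (hK : ∀ c : X, ∀ a : X, ∑ i, m i • radialSqrt (x i - c) = a →
      ∑ i, m i * ‖radialSqrt (x i - c) - a‖ ^ 2 ≤ K) :
    ∑ i, ∑ j, m i * m j * ‖x i - x j‖ ≤ 16 * K := by
  obtain ⟨c, hc⟩ := exists_sum_dist_le hm hm1 x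
  set S := ∑ i, ∑ j, m i * m j * ‖x i - x j‖ with hS
  set f : V → X := fun i => radialSqrt (x i - c) with hf
  set a := ∑ i, m i • f i with ha
  have hS0 : 0 ≤ S := Finset.sum_nonneg fun i _ => Finset.sum_nonneg fun j _ =>
    mul_nonneg (mul_nonneg (hm i) (hm j)) (norm_nonneg _)
  have hKa := hK c a rfl
  have hfsq : ∑ i, m i * ‖f i‖ ^ 2 ≤ S := by
    simp_rw [hf, norm_radialSqrt_sq]; exact hc
  have ha2 : ‖a‖ ^ 2 ≤ S := by
    refine le_trans ?_ hfsq
    have h1 : ‖a‖ ≤ ∑ i, m i * ‖f i‖ := by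
      refine (norm_sum_le _ _).trans (Finset.sum_le_sum fun i _ => ?_)
      rw [norm_smul, Real.norm_of_nonneg (hm i)]
    exact (pow_le_pow_left₀ (norm_nonneg _) h1 2).trans
      (Real.pow_arith_mean_le_arith_mean_pow _ _ _ (fun j _ => hm j) hm1
        (fun j _ => norm_nonneg _) 2)
  -- Recenter at the point whose radial image about `c` is the mean `a`.
  have h1 : S ≤ 2 * ∑ i, m i * (‖f i - a‖ * (‖f i‖ + ‖a‖)) := by
    refine (sum_mul_mul_dist_le hm hm1 x (c + ‖a‖ • a)).trans ?_
    refine mul_le_mul_of_nonneg_left (Finset.sum_le_sum fun i _ => ?_) zero_le_two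
    refine mul_le_mul_of_nonneg_left ?_ (hm i)
    have e : x i - (c + ‖a‖ • a) = ‖f i‖ • f i - ‖a‖ • a := by
      rw [hf, norm_smul_radialSqrt]; abel
    rw [e]
    exact norm_norm_smul_sub_norm_smul_le _ _
  have h2 : (∑ i, m i * (‖f i - a‖ * (‖f i‖ + ‖a‖))) ^ 2
      ≤ (∑ i, m i * ‖f i - a‖ ^ 2) * ∑ i, m i * (‖f i‖ + ‖a‖) ^ 2 :=
    Finset.sum_sq_le_sum_mul_sum_of_sq_le_mul _ (fun j _ => mul_nonneg (hm j) (sq_nonneg _))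
      (fun j _ => mul_nonneg (hm j) (sq_nonneg _)) fun j _ => le_of_eq (by ring)
  have h3 : ∑ i, m i * (‖f i‖ + ‖a‖) ^ 2 ≤ 4 * S := by
    calc ∑ i, m i * (‖f i‖ + ‖a‖) ^ 2
        ≤ ∑ i, (2 * (m i * ‖f i‖ ^ 2) + m i * (2 * ‖a‖ ^ 2)) :=
          Finset.sum_le_sum fun i _ => by
            nlinarith [mul_nonneg (hm i) (sq_nonneg (‖f i‖ - ‖a‖))]
      _ = 2 * ∑ i, m i * ‖f i‖ ^ 2 + 2 * ‖a‖ ^ 2 := by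
          rw [Finset.sum_add_distrib, ← Finset.mul_sum, ← Finset.sum_mul, hm1, one_mul]
      _ ≤ 4 * S := by linarith
  have h40 : 0 ≤ ∑ i, m i * ‖f i - a‖ ^ 2 :=
    Finset.sum_nonneg fun i _ => mul_nonneg (hm i) (sq_nonneg _)
  have h50 : 0 ≤ ∑ i, m i * (‖f i - a‖ * (‖f i‖ + ‖a‖)) :=
    Finset.sum_nonneg fun i _ => mul_nonneg (hm i) (by positivity)
  have hK0 : 0 ≤ K := h40.trans hKa
  -- Cauchy–Schwarz bounds `S²` by `4 · K · 4 S`; one factor `S` then cancels.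
  have h6 : S ^ 2 ≤ S * (16 * K) := by
    calc S ^ 2 ≤ (2 * ∑ i, m i * (‖f i - a‖ * (‖f i‖ + ‖a‖))) ^ 2 := pow_le_pow_left₀ hS0 h1 2
      _ ≤ 4 * ((∑ i, m i * ‖f i - a‖ ^ 2) * ∑ i, m i * (‖f i‖ + ‖a‖) ^ 2) := by
          rw [mul_pow]; linarith
      _ ≤ 4 * (K * (4 * S)) :=
          mul_le_mul_of_nonneg_left (mul_le_mul hKa h3 (Finset.sum_nonneg fun i _ =>
            mul_nonneg (hm i) (sq_nonneg _)) hK0) (by norm_num)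
      _ = _ := by ring
  rcases hS0.eq_or_lt with h | h
  · rw [← h]; positivity
  · rw [sq] at h6
    exact le_of_mul_le_mul_left h6 h

/-- Take `k = ⌈log (4 n²) / ε⌉`. The rounding costs at most `ε ≤ 1 ≤ 2 log (n + 1)`, and `4 n² ≤ (n
+ 1)⁴`; hence the 6. -/
theorem exists_pow_le_and_mul_le {n : ℕ} (hn : 1 ≤ n) {ε : ℝ} (hε0 : 0 < ε) (hε1 : ε ≤ 1) :
    ∃ k : ℕ, (n : ℝ) ^ 2 * (1 - ε) ^ k ≤ 1 / 4 ∧ k * ε ≤ 6 * Real.log ((n : ℝ) + 1) := by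
  have hn' : (1 : ℝ) ≤ n := by exact_mod_cast hn
  set L := Real.log (4 * (n : ℝ) ^ 2) with hL
  have hL0 : 0 ≤ L := Real.log_nonneg (by nlinarith)
  refine ⟨⌈L / ε⌉₊, ?_, ?_⟩
  · have h1 : (1 - ε) ^ ⌈L / ε⌉₊ ≤ Real.exp (-L) := by
      calc (1 - ε) ^ ⌈L / ε⌉₊ ≤ Real.exp (-ε) ^ ⌈L / ε⌉₊ :=
            pow_le_pow_left₀ (by linarith) (by linarith [Real.add_one_le_exp (-ε)]) _
        _ = Real.exp (-(⌈L / ε⌉₊ * ε)) := by rw [← Real.exp_nat_mul]; ring_nf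
        _ ≤ Real.exp (-L) := by
            rw [Real.exp_le_exp, neg_le_neg_iff, ← div_le_iff₀ hε0]
            exact Nat.le_ceil _
    have h2 : Real.exp (-L) = 1 / (4 * (n : ℝ) ^ 2) := by
      rw [Real.exp_neg, hL, Real.exp_log (by positivity), one_div]
    calc (n : ℝ) ^ 2 * (1 - ε) ^ ⌈L / ε⌉₊ ≤ (n : ℝ) ^ 2 * (1 / (4 * (n : ℝ) ^ 2)) := by
          rw [← h2]; gcongr
      _ = 1 / 4 := by field_simp
  · have h1 : (⌈L / ε⌉₊ : ℝ) * ε ≤ L + 1 := by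
      have := (Nat.ceil_lt_add_one (div_nonneg hL0 hε0.le)).le
      calc (⌈L / ε⌉₊ : ℝ) * ε ≤ (L / ε + 1) * ε := by gcongr
        _ = L + ε := by field_simp
        _ ≤ _ := by linarith
    have h2 : L ≤ 4 * Real.log ((n : ℝ) + 1) := by
      have : (4 : ℝ) * Real.log ((n : ℝ) + 1) = Real.log (((n : ℝ) + 1) ^ 4) := by
        rw [Real.log_pow]; norm_num
      rw [this]
      refine Real.log_le_log (by positivity) ?_
      nlinarith [sq_nonneg ((n : ℝ) - 1), sq_nonneg ((n : ℝ) + 1)]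
    have h3 : 1 / 2 ≤ Real.log ((n : ℝ) + 1) := by
      have := Real.log_le_log zero_lt_two (by linarith : (2 : ℝ) ≤ n + 1)
      linarith [Real.log_two_gt_d9]
    linarith

/-- Weighted graphs with a spectral gap satisfy an `L₁` Poincaré inequality with values in any
`n`-dimensional normed space, with a loss of `O(log n)`. -/
theorem linear_poincare_of_pos {X : Type*} [NormedAddCommGroup X] [NormedSpace ℝ X]
    [FiniteDimensional ℝ X] (hX : 1 ≤ Module.finrank ℝ X) {m : V → ℝ} {w : V → V → ℝ}
    (hm : ∀ i, 0 < m i) (hm1 : ∑ i, m i = 1) (hw : ∀ i j, 0 ≤ w i j)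
    (hsymm : ∀ i j, w i j = w j i)
    (hgap : ∀ g : V → ℝ, ∑ i, ∑ j, m i * m j * (g i - g j) ^ 2
      ≤ ∑ i, ∑ j, w i j * (g i - g j) ^ 2) (x : V → X) :
    ∑ i, ∑ j, m i * m j * ‖x i - x j‖
      ≤ 3072 * Real.log ((Module.finrank ℝ X : ℝ) + 1) * ∑ i, ∑ j, w i j * ‖x i - x j‖ := by
  classical
  obtain ⟨ε, hε0, hε1, P, hP, hPw⟩ := exists_isContractiveChain hm hm1 hw hsymm hgap
  obtain ⟨k, hk1, hk2⟩ := exists_pow_le_and_mul_le hX hε0 hε1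
  have hρ : 0 ≤ 1 - ε := by linarith
  have hm0 : ∀ i, 0 ≤ m i := fun i => (hm i).le
  have hQ := hP.pow hρ k
  set R := ∑ i, ∑ j, w i j * ‖x i - x j‖ with hR
  have hR0 : 0 ≤ R := Finset.sum_nonneg fun i _ => Finset.sum_nonneg fun j _ =>
    mul_nonneg (hw i j) (norm_nonneg _)
  have hPR : ∑ i, m i * ∑ j, P i j * dist (x i) (x j) = ε * R := by
    rw [hR, Finset.mul_sum]
    refine Finset.sum_congr rfl fun i _ => ?_
    rw [Finset.mul_sum, Finset.mul_sum]
    refine Finset.sum_congr rfl fun j _ => ?_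
    rcases eq_or_ne i j with rfl | hij
    · simp
    · rw [← mul_assoc, hPw i j hij, dist_eq_norm, mul_assoc]
  have hQR : ∑ i, m i * ∑ j, (P ^ k) i j * ‖x i - x j‖
      ≤ 6 * Real.log ((Module.finrank ℝ X : ℝ) + 1) * R := by
    have := hP.sum_pow_mul_dist_le hρ hm0 x k
    simp_rw [hPR, dist_eq_norm] at this
    refine this.trans ?_
    rw [← mul_assoc]
    exact mul_le_mul_of_nonneg_right hk2 hR0
  -- The factors are 4 from the quadratic Poincaré inequality, 8 from the Hölder bound of the radial
  -- map and 6 from `k ε`; with the outer 16 they give 3072.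
  have hmain := sum_mul_mul_norm_sub_le_of_radialSqrt hm0 hm1 x
    (K := 4 * (8 * (6 * Real.log ((Module.finrank ℝ X : ℝ) + 1) * R))) (by
      intro c a ha
      have h1 := hQ.sum_norm_sq_le (pow_nonneg hρ k) hm0 hk1
        (fun i => radialSqrt (x i - c) - a) (by
          simp_rw [smul_sub]
          rw [Finset.sum_sub_distrib, ha, ← Finset.sum_smul, hm1, one_smul, sub_self])
      refine h1.trans (mul_le_mul_of_nonneg_left ?_ (by norm_num))
      refine le_trans ?_ (mul_le_mul_of_nonneg_left hQR (by norm_num))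
      rw [Finset.mul_sum]
      refine Finset.sum_le_sum fun i _ => ?_
      rw [mul_left_comm]
      refine mul_le_mul_of_nonneg_left ?_ (hm0 i)
      rw [Finset.mul_sum]
      refine Finset.sum_le_sum fun j _ => ?_
      rw [mul_left_comm]
      refine mul_le_mul_of_nonneg_left ?_ (hQ.nonneg i j)
      have := norm_radialSqrt_sub_sq_le (x i - c) (x j - c)
      rwa [sub_sub_sub_cancel_right] at this ⊢)
  linarith

/-- Removes strict positivity of `m` and symmetry of `w`. Symmetrizing `w` changes neither side;
adding `ε` to each mass and the excess of the new products to `w` preserves the gap, and then `ε →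
0`. -/
theorem linear_poincare {X : Type*} [NormedAddCommGroup X] [NormedSpace ℝ X]
    [FiniteDimensional ℝ X] (hX : 1 ≤ Module.finrank ℝ X) {m : V → ℝ} {w : V → V → ℝ}
    (hm : ∀ i, 0 ≤ m i) (hm1 : ∑ i, m i = 1) (hw : ∀ i j, 0 ≤ w i j)
    (hgap : ∀ g : V → ℝ, ∑ i, ∑ j, m i * m j * (g i - g j) ^ 2
      ≤ ∑ i, ∑ j, w i j * (g i - g j) ^ 2) (x : V → X) :
    ∑ i, ∑ j, m i * m j * ‖x i - x j‖
      ≤ 3072 * Real.log ((Module.finrank ℝ X : ℝ) + 1) * ∑ i, ∑ j, w i j * ‖x i - x j‖ := by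
  set L := 3072 * Real.log ((Module.finrank ℝ X : ℝ) + 1) with hL
  have hL0 : 0 ≤ L := mul_nonneg (by norm_num) (Real.log_nonneg (by simp))
  have hswap : ∀ F : V → V → ℝ, (∀ i j, F i j = F j i) →
      ∑ i, ∑ j, (w i j + w j i) / 2 * F i j = ∑ i, ∑ j, w i j * F i j := by
    intro F hF
    have : ∑ i, ∑ j, w j i * F i j = ∑ i, ∑ j, w i j * F i j := by
      rw [Finset.sum_comm]
      exact Finset.sum_congr rfl fun i _ => Finset.sum_congr rfl fun j _ => by rw [hF]
    calc ∑ i, ∑ j, (w i j + w j i) / 2 * F i j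
        = ∑ i, ∑ j, (w i j * F i j / 2 + w j i * F i j / 2) :=
          Finset.sum_congr rfl fun i _ => Finset.sum_congr rfl fun j _ => by ring
      _ = _ := by
          simp_rw [Finset.sum_add_distrib, ← Finset.sum_div]
          rw [this]; ring
  set N : ℝ := ((Fintype.card V : ℕ) : ℝ) with hN
  have hN0 : 0 ≤ N := Nat.cast_nonneg _
  have main : ∀ ε : ℝ, 0 < ε → ∑ i, ∑ j, m i * m j * ‖x i - x j‖
      ≤ (1 + N * ε) ^ 2 * (L * ∑ i, ∑ j,
        ((w i j + w j i) / 2 + ε * (m i + m j) + ε ^ 2) * ‖x i - x j‖) := by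
    intro ε hε
    have hM : 1 ≤ 1 + N * ε := by nlinarith
    have hM0 : 0 < 1 + N * ε := by linarith
    have hle : ∀ (F : V → V → ℝ), (∀ i j, 0 ≤ F i j) →
        ∑ i, ∑ j, m i * m j * F i j
          ≤ (1 + N * ε) ^ 2 *
            ∑ i, ∑ j, (m i + ε) / (1 + N * ε) * ((m j + ε) / (1 + N * ε)) * F i j := by
      intro F hF
      simp_rw [Finset.mul_sum]
      refine Finset.sum_le_sum fun i _ => Finset.sum_le_sum fun j _ => ?_
      have e : (1 + N * ε) ^ 2 * ((m i + ε) / (1 + N * ε) * ((m j + ε) / (1 + N * ε)) * F i j)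
          = (m i + ε) * (m j + ε) * F i j := by field_simp
      rw [e]
      refine mul_le_mul_of_nonneg_right ?_ (hF i j)
      have := hm i
      have := hm j
      gcongr <;> linarith
    refine (hle (fun i j => ‖x i - x j‖) fun i j => norm_nonneg _).trans ?_
    refine mul_le_mul_of_nonneg_left ?_ (by positivity)
    refine linear_poincare_of_pos (m := fun i => (m i + ε) / (1 + N * ε)) hX (fun i => ?_) ?_
      (fun i j => ?_) (fun i j => ?_) (fun g => ?_) x
    · have := hm i
      positivity
    · rw [← Finset.sum_div, Finset.sum_add_distrib, hm1]
      simp only [Finset.sum_const, Finset.card_univ, nsmul_eq_mul]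
      exact div_self hM0.ne'
    · have := hm i
      have := hm j
      have := hw i j
      have := hw j i
      positivity
    · ring
    · calc ∑ i, ∑ j, (m i + ε) / (1 + N * ε) * ((m j + ε) / (1 + N * ε)) * (g i - g j) ^ 2
          ≤ ∑ i, ∑ j, (m i + ε) * (m j + ε) * (g i - g j) ^ 2 := by
            refine Finset.sum_le_sum fun i _ => Finset.sum_le_sum fun j _ => ?_
            have h1 : 0 ≤ m i + ε := by linarith [hm i]
            have h2 : 0 ≤ m j + ε := by linarith [hm j]
            refine mul_le_mul_of_nonneg_right ?_ (sq_nonneg _)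
            exact mul_le_mul (div_le_self h1 hM) (div_le_self h2 hM) (by positivity) h1
        _ = ∑ i, ∑ j, m i * m j * (g i - g j) ^ 2
            + ∑ i, ∑ j, (ε * (m i + m j) + ε ^ 2) * (g i - g j) ^ 2 := by
            simp_rw [← Finset.sum_add_distrib]
            exact Finset.sum_congr rfl fun i _ => Finset.sum_congr rfl fun j _ => by ring
        _ ≤ ∑ i, ∑ j, (w i j + w j i) / 2 * (g i - g j) ^ 2
            + ∑ i, ∑ j, (ε * (m i + m j) + ε ^ 2) * (g i - g j) ^ 2 := by
            rw [hswap (fun i j => (g i - g j) ^ 2) fun i j => by ring]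
            linarith [hgap g]
        _ = _ := by
            simp_rw [← Finset.sum_add_distrib]
            exact Finset.sum_congr rfl fun i _ => Finset.sum_congr rfl fun j _ => by ring
  have hlim : Filter.Tendsto (fun ε : ℝ => (1 + N * ε) ^ 2 * (L * ∑ i, ∑ j,
        ((w i j + w j i) / 2 + ε * (m i + m j) + ε ^ 2) * ‖x i - x j‖)) (nhdsWithin 0 (Set.Ioi 0))
      (nhds (L * ∑ i, ∑ j, w i j * ‖x i - x j‖)) := by
    have hc : Continuous fun ε : ℝ => (1 + N * ε) ^ 2 * (L * ∑ i, ∑ j,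
        ((w i j + w j i) / 2 + ε * (m i + m j) + ε ^ 2) * ‖x i - x j‖) := by fun_prop
    have h0 := hc.tendsto 0
    simp only [mul_zero, add_zero, one_pow, one_mul, zero_mul, ne_eq, OfNat.ofNat_ne_zero,
      not_false_eq_true, zero_pow] at h0
    rw [hswap (fun i j => ‖x i - x j‖) fun i j => norm_sub_rev _ _] at h0
    exact h0.mono_left nhdsWithin_le_nhds
  exact ge_of_tendsto hlim (Filter.eventually_of_mem self_mem_nhdsWithin fun ε hε => main ε hε)

end SpectralGap

/-! ### Duality between Euclidean embeddings and Poincaré inequalities. -/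

section Duality

variable {V : Type*} [Fintype V]

theorem map_prod_pi_eq_sum [DecidableEq V] (φ : StrongDual ℝ ((V × V → ℝ) × ℝ)) (u : V × V → ℝ)
    (r : ℝ) :
    φ (u, r) = ∑ i, ∑ j, φ (Pi.single (i, j) 1, 0) * u (i, j) + φ (0, 1) * r := by
  have e : (u, r) = ∑ p : V × V, u p • ((Pi.single p 1, 0) : (V × V → ℝ) × ℝ)
      + r • ((0, 1) : (V × V → ℝ) × ℝ) := by
    refine Prod.ext ?_ ?_
    · ext p
      simp [Prod.fst_sum, Finset.sum_apply, Pi.single_apply]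
    · simp [Prod.snd_sum]
  conv_lhs => rw [e]
  rw [map_add, map_sum, map_smul, smul_eq_mul, mul_comm r, Fintype.sum_prod_type]
  congr 1
  refine Finset.sum_congr rfl fun i _ => Finset.sum_congr rfl fun j _ => ?_
  rw [map_smul, smul_eq_mul, mul_comm]

/-- Squared Euclidean distances are linear in the Gram matrix, and Gram matrices form a convex cone;
the second component is linear in the first. -/
theorem convex_sqDist_of_posSemidef (q : V → V → ℝ) :
    Convex ℝ {z : (V × V → ℝ) × ℝ | ∃ G : Matrix V V ℝ, G.PosSemidef ∧
      (∀ i j, z.1 (i, j) = G i i + G j j - 2 * G i j) ∧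
      z.2 = ∑ i, ∑ j, q i j * z.1 (i, j)} := by
  rintro y ⟨G, hG, hG1, hG2⟩ z ⟨H, hH, hH1, hH2⟩ a b ha hb -
  refine ⟨a • G + b • H, (hG.smul ha).add (hH.smul hb), fun i j => ?_, ?_⟩
  · simp [hG1, hH1]; ring
  · simp only [Prod.snd_add, Prod.smul_snd, Prod.fst_add, Prod.smul_fst, Pi.add_apply,
      Pi.smul_apply, smul_eq_mul, hG2, hH2, Finset.mul_sum, ← Finset.sum_add_distrib]
    exact Finset.sum_congr rfl fun i _ => Finset.sum_congr rfl fun j _ => by ring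

theorem Matrix.PosSemidef.exists_euclidean {G : Matrix V V ℝ} (hG : G.PosSemidef) :
    ∃ (n : ℕ) (f : V → EuclideanSpace ℝ (Fin n)),
      ∀ i j, ‖f i - f j‖ ^ 2 = G i i + G j j - 2 * G i j := by
  obtain ⟨n, v, rfl⟩ := Matrix.posSemidef_iff_eq_sum_vecMulVec.1 hG
  refine ⟨n, fun i => WithLp.toLp 2 fun l => v l i, fun i j => ?_⟩
  rw [EuclideanSpace.norm_sq_eq]
  simp only [PiLp.sub_apply, Real.norm_eq_abs, sq_abs, Matrix.sum_apply, Matrix.vecMulVec_apply,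
    star_trivial, Finset.mul_sum, ← Finset.sum_add_distrib, ← Finset.sum_sub_distrib]
  exact Finset.sum_congr rfl fun l _ => by ring

/-- Duality between Euclidean embeddings which are large on average and Poincaré inequalities. -/
theorem exists_euclidean_of_duality {q N : V → V → ℝ} (hN0 : ∀ i, N i i = 0)
    (hN : ∀ i j, i ≠ j → 0 < N i j) {S : ℝ}
    (hdual : ∀ w : V → V → ℝ, (∀ i j, 0 ≤ w i j) →
      (∀ g : V → ℝ, ∑ i, ∑ j, q i j * (g i - g j) ^ 2 ≤ ∑ i, ∑ j, w i j * (g i - g j) ^ 2) →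
      S < ∑ i, ∑ j, w i j * N i j) :
    ∃ (n : ℕ) (f : V → EuclideanSpace ℝ (Fin n)), (∀ i j, ‖f i - f j‖ ^ 2 ≤ N i j) ∧
      S < ∑ i, ∑ j, q i j * ‖f i - f j‖ ^ 2 := by
  classical
  set A := {z : (V × V → ℝ) × ℝ | ∃ G : Matrix V V ℝ, G.PosSemidef ∧
      (∀ i j, z.1 (i, j) = G i i + G j j - 2 * G i j) ∧
      z.2 = ∑ i, ∑ j, q i j * z.1 (i, j)} with hA
  -- The added diagonal makes every bound positive, so that the box `B` contains points with first
  -- component 0. It is harmless because distances vanish on the diagonal.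
  set N' : V × V → ℝ := fun p => N p.1 p.2 + if p.1 = p.2 then 1 else 0 with hN'
  have hN'0 : ∀ p, 0 < N' p := by
    rintro ⟨i, j⟩
    rcases eq_or_ne i j with rfl | h
    · simp [hN', hN0]
    · simpa [hN', h] using hN i j h
  set B := (Set.univ.pi fun p => Set.Iio (N' p)) ×ˢ Set.Ioi S with hB
  have hBo : IsOpen B := (isOpen_set_pi Set.finite_univ fun p _ => isOpen_Iio).prod isOpen_Ioi
  have hBc : Convex ℝ B := (convex_pi fun p _ => convex_Iio _).prod (convex_Ioi _)
  by_cases hdisj : Disjoint B A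
  swap
  · obtain ⟨z, ⟨hz1, hz2⟩, G, hG, hG1, hG2⟩ := Set.not_disjoint_iff.1 hdisj
    obtain ⟨n, f, hf⟩ := hG.exists_euclidean
    refine ⟨n, f, fun i j => ?_, ?_⟩
    · rcases eq_or_ne i j with rfl | h
      · simp [hN0]
      · have := hz1 (i, j) (Set.mem_univ _)
        rw [hf, ← hG1]
        simpa [hN', h] using (show z.1 (i, j) < N' (i, j) from this).le
    · simp_rw [hf, ← hG1]
      rw [← hG2]
      exact hz2
  exfalso
  obtain ⟨φ, u, hφB, hφA⟩ :=
    geometric_hahn_banach_open hBc hBo (convex_sqDist_of_posSemidef q) hdisj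
  set w : V → V → ℝ := fun i j => φ (Pi.single (i, j) 1, 0) with hw
  set c := -φ (0, 1) with hc
  have hφ : ∀ v r, φ (v, r) = ∑ i, ∑ j, w i j * v (i, j) - c * r := by
    intro v r
    rw [map_prod_pi_eq_sum, hc]; ring
  have hu : u ≤ 0 := by
    have := hφA 0 ⟨0, Matrix.PosSemidef.zero, by simp, by simp⟩
    simpa using this
  -- `A` is a cone, so a functional bounded below on it is nonnegative on it.
  have hnonneg : ∀ z ∈ A, 0 ≤ φ z := by
    rintro z ⟨G, hG, hG1, hG2⟩
    by_contra! hneg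
    set t := (u - 1) / φ z with ht
    have ht0 : 0 ≤ t := div_nonneg_of_nonpos (by linarith) hneg.le
    have h1 := hφA (t • z) ⟨t • G, hG.smul ht0, fun i j => by
      simp [hG1]; ring, by
      simp only [Prod.smul_snd, Prod.smul_fst, Pi.smul_apply, smul_eq_mul, hG2, Finset.mul_sum]
      exact Finset.sum_congr rfl fun i _ => Finset.sum_congr rfl fun j _ => by ring⟩
    rw [map_smul, smul_eq_mul, ht, div_mul_cancel₀ _ hneg.ne] at h1
    linarith
  have hc0 : 0 ≤ c := by
    by_contra! hneg
    have h1 : ∀ t : ℝ, 0 ≤ t → -(c * (S + 1 + t)) < u := by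
      intro t ht
      have := hφB (0, S + 1 + t) ⟨fun p _ => hN'0 p, by
        rw [Set.mem_Ioi]; linarith⟩
      rw [hφ] at this
      simpa using this
    have h2 := h1 (|S + 1|) (abs_nonneg _)
    have : 0 ≤ S + 1 + |S + 1| := by linarith [neg_abs_le (S + 1)]
    nlinarith
  have hw0 : ∀ i j, 0 ≤ w i j := by
    intro i j
    by_contra! hneg
    have h1 : ∀ t : ℝ, 0 ≤ t → -(t * w i j) - c * (S + 1) < 0 := by
      intro t ht
      have := hφB (-(t • Pi.single (i, j) 1), S + 1) ⟨fun p _ => by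
        have : 0 ≤ t * (Pi.single (i, j) 1 : V × V → ℝ) p :=
          mul_nonneg ht (by rw [Pi.single_apply]; split_ifs <;> norm_num)
        have h2 := hN'0 p
        simp only [Pi.neg_apply, Pi.smul_apply, smul_eq_mul, Set.mem_Iio]
        linarith, by
        rw [Set.mem_Ioi]; linarith⟩
      have e : ((-(t • Pi.single (i, j) 1), S + 1) : (V × V → ℝ) × ℝ)
          = -(t • (Pi.single (i, j) 1, 0)) + (S + 1) • (0, 1) := by
        ext <;> simp
      rw [e, map_add, map_neg, map_smul, map_smul, smul_eq_mul, smul_eq_mul] at this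
      have e2 : c * (S + 1) = -((S + 1) * φ (0, 1)) := by rw [hc]; ring
      rw [e2]
      change -(t * φ (Pi.single (i, j) 1, 0)) - _ < 0
      linarith
    have h2 := h1 (|c * (S + 1)| / -w i j) (div_nonneg (abs_nonneg _) (by linarith))
    have e3 : -(|c * (S + 1)| / -w i j * w i j) = |c * (S + 1)| := by
      have := hneg.ne
      field_simp
    rw [e3] at h2
    linarith [le_abs_self (c * (S + 1))]
  -- The rank-one Gram matrix `g gᵀ` turns nonnegativity on the cone into the scalar Poincaré
  -- inequality.
  have hgap : ∀ g : V → ℝ, c * ∑ i, ∑ j, q i j * (g i - g j) ^ 2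
      ≤ ∑ i, ∑ j, w i j * (g i - g j) ^ 2 := by
    intro g
    have := hnonneg (fun p => (g p.1 - g p.2) ^ 2, ∑ i, ∑ j, q i j * (g i - g j) ^ 2)
      ⟨Matrix.vecMulVec g (star g), Matrix.posSemidef_vecMulVec_self_star g, fun i j => by
        simp [Matrix.vecMulVec_apply]; ring, rfl⟩
    rw [hφ] at this
    linarith
  set a := ∑ i, ∑ j, w i j * N' (i, j) with ha
  have ha0 : 0 ≤ a := Finset.sum_nonneg fun i _ => Finset.sum_nonneg fun j _ =>
    mul_nonneg (hw0 i j) (hN'0 _).le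
  -- Approach the corner `(N', S)` of the open set `B` from inside.
  have hac : a ≤ c * S := by
    by_contra! hlt
    have h1 : ∀ s : ℝ, 0 < s → s < 1 → (1 - s) * a - c * (S + s) < 0 := by
      intro s hs hs1
      have := hφB ((1 - s) • N', S + s) ⟨fun p _ => by
        have := hN'0 p
        simp only [Pi.smul_apply, smul_eq_mul, Set.mem_Iio]
        nlinarith, by rw [Set.mem_Ioi]; linarith⟩
      rw [hφ] at this
      have e : ∑ i, ∑ j, w i j * ((1 - s) • N') (i, j) = (1 - s) * a := by
        rw [ha]
        simp_rw [Finset.mul_sum]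
        exact Finset.sum_congr rfl fun i _ => Finset.sum_congr rfl fun j _ => by
          simp only [Pi.smul_apply, smul_eq_mul]; ring
      rw [e] at this
      linarith
    set d := a - c * S with hd
    have hd0 : 0 < d := by linarith
    have hs := h1 (d / (d + a + c + 1)) (by positivity) (by
      rw [div_lt_one (by positivity)]; linarith)
    have e : d / (d + a + c + 1) * (d + a + c + 1) = d := div_mul_cancel₀ _ (by positivity)
    have : 0 < d / (d + a + c + 1) := by positivity
    nlinarith
  -- If `c = 0` then `w = 0`, so `φ` vanishes and cannot separate strictly. Otherwise `w / c`
  -- contradicts `hdual`.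
  rcases hc0.eq_or_lt with hc0 | hc0
  · have ha' : a = 0 := le_antisymm (by rw [← hc0] at hac; linarith) ha0
    have hwz : ∀ i j, w i j = 0 := by
      intro i j
      have h1 := (Finset.sum_eq_zero_iff_of_nonneg fun i _ => Finset.sum_nonneg fun j _ =>
        mul_nonneg (hw0 i j) (hN'0 (i, j)).le).1 ha' i (Finset.mem_univ i)
      have h2 := (Finset.sum_eq_zero_iff_of_nonneg fun j _ =>
        mul_nonneg (hw0 i j) (hN'0 (i, j)).le).1 h1 j (Finset.mem_univ j)
      exact (mul_eq_zero.1 h2).resolve_right (hN'0 _).ne'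
    have := hφB (0, S + 1) ⟨fun p _ => hN'0 p, by rw [Set.mem_Ioi]; linarith⟩
    rw [hφ, ← hc0] at this
    simp [hwz] at this
    linarith
  · have h1 := hdual (fun i j => w i j / c) (fun i j => div_nonneg (hw0 i j) hc0.le) (fun g => by
      have := hgap g
      rw [mul_comm, ← le_div_iff₀ hc0] at this
      refine this.trans_eq ?_
      simp_rw [Finset.sum_div]
      exact Finset.sum_congr rfl fun i _ => Finset.sum_congr rfl fun j _ => by ring)
    have h2 : ∑ i, ∑ j, w i j / c * N i j ≤ a / c := by
      rw [ha]
      simp_rw [Finset.sum_div]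
      refine Finset.sum_le_sum fun i _ => Finset.sum_le_sum fun j _ => ?_
      rw [div_mul_eq_mul_div]
      have : N i j ≤ N' (i, j) := by
        simp only [hN']
        split_ifs <;> linarith
      have := hw0 i j
      gcongr
    have h3 : a / c ≤ S := by
      rw [div_le_iff₀ hc0]; linarith
    linarith

end Duality

/-! ### Maps defined on the whole space. -/

section Extension

theorem Orthonormal.exists_linearIsometry {E E' : Type*} [NormedAddCommGroup E]
    [InnerProductSpace ℝ E] [FiniteDimensional ℝ E] [NormedAddCommGroup E'] [InnerProductSpace ℝ E']
    {v : Fin (Module.finrank ℝ E) → E'} (hv : Orthonormal ℝ v) : Nonempty (E →ₗᵢ[ℝ] E') := by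
  let b := stdOrthonormalBasis ℝ E
  refine ⟨(b.toBasis.constr ℝ v).isometryOfOrthonormal (v := b.toBasis) ?_ ?_⟩
  · simp
  · have : (b.toBasis.constr ℝ v) ∘ b.toBasis = v := by
      ext i
      simp only [Function.comp_apply, Module.Basis.constr_basis]
    rw [this]
    exact hv

theorem nonempty_linearIsometry_ellTwo (E : Type*) [NormedAddCommGroup E] [InnerProductSpace ℝ E]
    [FiniteDimensional ℝ E] : Nonempty (E →ₗᵢ[ℝ] EllTwo) := by
  refine Orthonormal.exists_linearIsometry (v := fun k => lp.single 2 (k : ℕ) (1 : ℝ)) ?_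
  rw [orthonormal_iff_ite]
  intro i j
  rw [lp.inner_single_left, lp.single_apply]
  simp [Pi.single_apply, Fin.ext_iff]

/-- Project orthogonally onto the span of the image of `s`: distances do not increase, and those
within `s` are kept. The dimension no longer depends on `V`, as the compactness argument requires.
-/
theorem exists_euclidean_of_card_le {V : Type*} {n : ℕ} (f : V → EuclideanSpace ℝ (Fin n))
    {s : Finset V} {N : ℕ} (hs : s.card ≤ N) :
    ∃ f' : V → EuclideanSpace ℝ (Fin N), (∀ i j, ‖f' i - f' j‖ ≤ ‖f i - f j‖) ∧
      ∀ i ∈ s, ∀ j ∈ s, ‖f' i - f' j‖ = ‖f i - f j‖ := by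
  classical
  let U := Submodule.span ℝ ((s.image f : Finset _) : Set (EuclideanSpace ℝ (Fin n)))
  have hU : Module.finrank ℝ U ≤ N :=
    ((finrank_span_finset_le_card (R := ℝ) (s.image f)).trans Finset.card_image_le).trans hs
  obtain ⟨e⟩ : Nonempty (U →ₗᵢ[ℝ] EuclideanSpace ℝ (Fin N)) :=
    Orthonormal.exists_linearIsometry
      ((EuclideanSpace.basisFun (Fin N) ℝ).orthonormal.comp _ (Fin.castLE_injective hU))
  refine ⟨fun i => e (U.orthogonalProjectionOnto (f i)), fun i j => ?_, fun i hi j hj => ?_⟩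
  · rw [← map_sub, ← map_sub, e.norm_map]
    exact U.norm_orthogonalProjectionOnto_apply_le _
  · have hmem : f i - f j ∈ U :=
      U.sub_mem (Submodule.subset_span (Finset.mem_coe.2 (Finset.mem_image_of_mem f hi)))
        (Submodule.subset_span (Finset.mem_coe.2 (Finset.mem_image_of_mem f hj)))
    rw [← map_sub, ← map_sub, e.norm_map,
      U.orthogonalProjectionOnto_mem_subspace_eq_self ⟨f i - f j, hmem⟩]
    rfl

/-- Compactness: a map satisfying pairwise bounds exists if it exists on all finite sets. -/
theorem exists_map_of_forall_finset {X E : Type*} [NormedAddCommGroup E] [ProperSpace E]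
    {N q : X → X → ℝ} {s : Finset X} (hs : s.Nonempty) {S : ℝ}
    (h : ∀ F : Finset X, s ⊆ F → ∃ f : X → E, (∀ x ∈ F, ∀ y ∈ F, ‖f x - f y‖ ^ 2 ≤ N x y) ∧
      S ≤ ∑ x ∈ s, ∑ y ∈ s, q x y * ‖f x - f y‖ ^ 2) :
    ∃ f : X → E, (∀ x y, ‖f x - f y‖ ^ 2 ≤ N x y) ∧
      S ≤ ∑ x ∈ s, ∑ y ∈ s, q x y * ‖f x - f y‖ ^ 2 := by
  classical
  obtain ⟨x₀, hx₀⟩ := hs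
  -- Normalize `f x₀ = 0`; the pairwise bounds then confine `f` to a product of compact balls.
  have hK : IsCompact ((Set.univ.pi fun x => Metric.closedBall (0 : E) (Real.sqrt (N x x₀))) ∩
      {f | S ≤ ∑ x ∈ s, ∑ y ∈ s, q x y * ‖f x - f y‖ ^ 2}) := by
    refine (isCompact_univ_pi fun x => isCompact_closedBall _ _).inter_right ?_
    exact isClosed_le continuous_const (by fun_prop)
  obtain ⟨f, ⟨-, hfS⟩, hf⟩ := hK.inter_iInter_nonempty
    (fun p : X × X => {f : X → E | ‖f p.1 - f p.2‖ ^ 2 ≤ N p.1 p.2})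
    (fun p => isClosed_le (by fun_prop) continuous_const) (fun u => by
      set F := s ∪ (u.image Prod.fst ∪ u.image Prod.snd) with hF
      obtain ⟨f, hf1, hf2⟩ := h F Finset.subset_union_left
      have hsF : ∀ x ∈ s, x ∈ F := fun x hx => Finset.mem_union_left _ hx
      set g : X → E := fun x => if x ∈ F then f x - f x₀ else 0 with hg
      have hgF : ∀ x ∈ F, ∀ y ∈ F, g x - g y = f x - f y := by
        intro x hx y hy
        simp only [hg, if_pos hx, if_pos hy, sub_sub_sub_cancel_right]
      refine ⟨g, ⟨fun x _ => ?_, ?_⟩, ?_⟩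
      · rw [mem_closedBall_zero_iff]
        by_cases hx : x ∈ F
        · simp only [hg, if_pos hx]
          exact Real.le_sqrt_of_sq_le (hf1 x hx x₀ (hsF x₀ hx₀))
        · simp [hg, if_neg hx]
      · refine hf2.trans_eq (Finset.sum_congr rfl fun x hx => Finset.sum_congr rfl fun y hy => ?_)
        rw [hgF x (hsF x hx) y (hsF y hy)]
      · refine Set.mem_iInter₂.2 fun p hp => ?_
        have h1 : p.1 ∈ F := Finset.mem_union_right _
          (Finset.mem_union_left _ (Finset.mem_image_of_mem _ hp))
        have h2 : p.2 ∈ F := Finset.mem_union_right _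
          (Finset.mem_union_right _ (Finset.mem_image_of_mem _ hp))
        change ‖g p.1 - g p.2‖ ^ 2 ≤ _
        rw [hgF _ h1 _ h2]
        exact hf1 _ h1 _ h2)
  exact ⟨f, fun x y => Set.mem_iInter.1 hf (x, y), hfS⟩

/-- Finitely supported measures on an `n`-dimensional normed space: the `1/2`-snowflake maps to a
Euclidean space with quadratic average distortion `O(√log n)`. -/
theorem exists_euclidean_of_weights {X : Type*} [NormedAddCommGroup X] [NormedSpace ℝ X]
    [FiniteDimensional ℝ X] (hX : 1 ≤ Module.finrank ℝ X) {s : Finset X} {m : X → ℝ}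
    (hm : ∀ x, 0 ≤ m x) (hms : ∀ x ∉ s, m x = 0) (hm1 : ∑ x ∈ s, m x = 1) {S : ℝ}
    (hS : S < ∑ x ∈ s, ∑ y ∈ s, m x * m y * ‖x - y‖) :
    ∃ f : X → EuclideanSpace ℝ (Fin s.card),
      (∀ x y, ‖f x - f y‖ ^ 2 ≤ 3072 * Real.log ((Module.finrank ℝ X : ℝ) + 1) * ‖x - y‖) ∧
      S ≤ ∑ x ∈ s, ∑ y ∈ s, m x * m y * ‖f x - f y‖ ^ 2 := by
  classical
  set L := 3072 * Real.log ((Module.finrank ℝ X : ℝ) + 1) with hL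
  have hL0 : 0 < L := mul_pos (by norm_num) (Real.log_pos (by
    have : (1 : ℝ) ≤ Module.finrank ℝ X := by exact_mod_cast hX
    linarith))
  have hs : s.Nonempty := by
    rw [Finset.nonempty_iff_ne_empty]
    rintro rfl
    simp at hm1
  refine exists_map_of_forall_finset (N := fun x y => L * ‖x - y‖) (q := fun x y => m x * m y)
    hs fun F hF => ?_
  have hsum : ∀ g : X → X → ℝ, ∑ i : F, ∑ j : F, m i * m j * g i j
      = ∑ x ∈ s, ∑ y ∈ s, m x * m y * g x y := by
    intro g
    rw [Finset.sum_coe_sort F fun x => ∑ j : F, m x * m j * g x j]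
    rw [← Finset.sum_subset hF fun x _ hx => by simp [hms x hx]]
    refine Finset.sum_congr rfl fun x _ => ?_
    rw [Finset.sum_coe_sort F fun y => m x * m y * g x y]
    rw [← Finset.sum_subset hF fun y _ hy => by simp [hms y hy]]
  have hm1' : ∑ i : F, m i = 1 := by
    rw [Finset.sum_coe_sort F m, ← hm1]
    exact (Finset.sum_subset hF fun x _ hx => hms x hx).symm
  -- The bounds are imposed on all of `F`, while the average sees only `s`, since the weights vanish
  -- off `s`.
  obtain ⟨n, f, hf1, hf2⟩ := exists_euclidean_of_duality (V := F)
    (q := fun i j => m i * m j) (N := fun i j => L * ‖(i : X) - j‖) (S := S) (by simp)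
    (fun i j hij => mul_pos hL0 (norm_pos_iff.2 (sub_ne_zero.2 (Subtype.coe_injective.ne hij))))
    (fun w hw hgap => by
      refine hS.trans_le ?_
      have := linear_poincare hX (fun i : F => hm i) hm1' hw hgap fun i => (i : X)
      rw [hsum fun x y => ‖x - y‖] at this
      refine this.trans_eq ?_
      simp_rw [Finset.mul_sum]
      exact Finset.sum_congr rfl fun i _ => Finset.sum_congr rfl fun j _ => by ring)
  set t : Finset F := Finset.univ.filter fun x => (x : X) ∈ s with ht
  have htc : t.card ≤ s.card :=
    Finset.card_le_card_of_injOn Subtype.val (fun x hx => (Finset.mem_filter.1 hx).2)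
      Subtype.val_injective.injOn
  have hmt : ∀ x (hx : x ∈ s), (⟨x, hF hx⟩ : F) ∈ t := fun x hx =>
    Finset.mem_filter.2 ⟨Finset.mem_univ _, hx⟩
  obtain ⟨f', hf'1, hf'2⟩ := exists_euclidean_of_card_le f htc
  refine ⟨fun x => if hx : x ∈ F then f' ⟨x, hx⟩ else 0, fun x hx y hy => ?_, ?_⟩
  · simp only [dif_pos hx, dif_pos hy]
    exact (pow_le_pow_left₀ (norm_nonneg _) (hf'1 _ _) 2).trans (hf1 ⟨x, hx⟩ ⟨y, hy⟩)
  · refine hf2.le.trans_eq ?_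
    have e : ∀ i j : F, ‖f i - f j‖ = ‖(if hx : (i : X) ∈ F then f ⟨i, hx⟩ else 0)
        - (if hy : (j : X) ∈ F then f ⟨j, hy⟩ else 0)‖ := fun i j => by simp
    simp_rw [e]
    rw [hsum fun x y => ‖(if hx : x ∈ F then f ⟨x, hx⟩ else 0)
        - (if hy : y ∈ F then f ⟨y, hy⟩ else 0)‖ ^ 2]
    refine Finset.sum_congr rfl fun x hx => Finset.sum_congr rfl fun y hy => ?_
    simp only [dif_pos (hF hx), dif_pos (hF hy)]
    rw [hf'2 _ (hmt x hx) _ (hmt y hy)]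

end Extension

/-! ### From finitely supported to arbitrary probability measures. -/

section Measure

theorem MeasureTheory.SimpleFunc.lintegral_comp_eq_sum {X Y : Type*} [MeasurableSpace X]
    (μ : Measure X) (T : SimpleFunc X Y) (g : Y → ℝ≥0∞) :
    ∫⁻ x, g (T x) ∂μ = ∑ a ∈ T.range, g a * μ (T ⁻¹' {a}) := by
  rw [← SimpleFunc.map_lintegral, ← SimpleFunc.lintegral_eq_lintegral]
  rfl

theorem MeasureTheory.SimpleFunc.lintegral_lintegral_ofReal {X Y : Type*} [MeasurableSpace X]
    (μ : Measure X) [IsFiniteMeasure μ] (T : SimpleFunc X Y) {h : Y → Y → ℝ}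
    (hh : ∀ a b, 0 ≤ h a b) :
    ∫⁻ x, ∫⁻ y, ENNReal.ofReal (h (T x) (T y)) ∂μ ∂μ
      = ENNReal.ofReal (∑ a ∈ T.range, ∑ b ∈ T.range,
        μ.real (T ⁻¹' {a}) * μ.real (T ⁻¹' {b}) * h a b) := by
  rw [T.lintegral_comp_eq_sum μ fun a => ∫⁻ y, ENNReal.ofReal (h a (T y)) ∂μ]
  rw [ENNReal.ofReal_sum_of_nonneg fun a _ => Finset.sum_nonneg fun b _ =>
    mul_nonneg (mul_nonneg measureReal_nonneg measureReal_nonneg) (hh a b)]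
  refine Finset.sum_congr rfl fun a _ => ?_
  rw [T.lintegral_comp_eq_sum μ fun b => ENNReal.ofReal (h a b),
    ENNReal.ofReal_sum_of_nonneg fun b _ =>
      mul_nonneg (mul_nonneg measureReal_nonneg measureReal_nonneg) (hh a b), Finset.sum_mul]
  refine Finset.sum_congr rfl fun b _ => ?_
  rw [ENNReal.ofReal_mul (mul_nonneg measureReal_nonneg measureReal_nonneg),
    ENNReal.ofReal_mul measureReal_nonneg, ofReal_measureReal, ofReal_measureReal]
  ring

variable {X : Type*} [NormedAddCommGroup X] [MeasurableSpace X]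

/-- If the first moment of `μ` is infinite, so is the double integral of `|√‖x‖ - √‖y‖|²`. -/
theorem lintegral_sqrt_norm_sub_sq_eq_top {μ : Measure X} [IsProbabilityMeasure μ]
    (h : ∫⁻ x, ∫⁻ y, edist x y ∂μ ∂μ = ∞) :
    ∫⁻ x, ∫⁻ y, ENNReal.ofReal ((Real.sqrt ‖x‖ - Real.sqrt ‖y‖) ^ 2) ∂μ ∂μ = ∞ := by
  have hM : ∫⁻ y, ‖y‖ₑ ∂μ = ∞ := by
    by_contra hM
    refine absurd h (ne_of_lt ?_)
    calc ∫⁻ x, ∫⁻ y, edist x y ∂μ ∂μ ≤ ∫⁻ x, (‖x‖ₑ + ∫⁻ y, ‖y‖ₑ ∂μ) ∂μ := by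
          refine lintegral_mono fun x => ?_
          calc ∫⁻ y, edist x y ∂μ ≤ ∫⁻ y, (‖x‖ₑ + ‖y‖ₑ) ∂μ := lintegral_mono fun y => by
                rw [edist_eq_enorm_sub]; exact enorm_sub_le
            _ = _ := by rw [lintegral_add_left measurable_const]; simp
      _ = (∫⁻ y, ‖y‖ₑ ∂μ) + ∫⁻ y, ‖y‖ₑ ∂μ := by
          rw [lintegral_add_right _ measurable_const]; simp
      _ < ∞ := by
          rw [ENNReal.add_lt_top]; exact ⟨lt_top_iff_ne_top.2 hM, lt_top_iff_ne_top.2 hM⟩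
  have hinner : ∀ x : X,
      ∫⁻ y, ENNReal.ofReal ((Real.sqrt ‖x‖ - Real.sqrt ‖y‖) ^ 2) ∂μ = ∞ := by
    intro x
    by_contra hx
    refine absurd hM (ne_of_lt ?_)
    calc ∫⁻ y, ‖y‖ₑ ∂μ
        ≤ ∫⁻ y, (2 * ENNReal.ofReal ((Real.sqrt ‖x‖ - Real.sqrt ‖y‖) ^ 2)
            + ENNReal.ofReal (2 * ‖x‖)) ∂μ := by
          refine lintegral_mono fun y => ?_
          rw [← ofReal_norm, ← ENNReal.ofReal_ofNat 2,
            ← ENNReal.ofReal_mul zero_le_two, ← ENNReal.ofReal_add (by positivity) (by positivity)]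
          refine ENNReal.ofReal_le_ofReal ?_
          have h1 := Real.sq_sqrt (norm_nonneg x)
          have h2 := Real.sq_sqrt (norm_nonneg y)
          nlinarith [sq_nonneg (2 * Real.sqrt ‖x‖ - Real.sqrt ‖y‖)]
      _ = 2 * ∫⁻ y, ENNReal.ofReal ((Real.sqrt ‖x‖ - Real.sqrt ‖y‖) ^ 2) ∂μ
            + ENNReal.ofReal (2 * ‖x‖) := by
          rw [lintegral_add_right _ measurable_const,
            lintegral_const_mul' _ _ ENNReal.ofNat_ne_top]
          simp
      _ < ∞ := by
          rw [ENNReal.add_lt_top]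
          exact ⟨ENNReal.mul_lt_top ENNReal.ofNat_lt_top (lt_top_iff_ne_top.2 hx),
            ENNReal.ofReal_lt_top⟩
  simp_rw [hinner]
  simp

theorem exists_simpleFunc_lintegral_lt [NormedSpace ℝ X] [FiniteDimensional ℝ X] [BorelSpace X]
    {μ : Measure X} [IsProbabilityMeasure μ] (h : ∫⁻ x, ∫⁻ y, edist x y ∂μ ∂μ ≠ ∞) {δ : ℝ≥0∞}
    (hδ : δ ≠ 0) : ∃ T : SimpleFunc X X, ∫⁻ x, ‖x - T x‖ₑ ∂μ < δ := by
  have : ProperSpace X := FiniteDimensional.proper ℝ X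
  have hfin : ∃ x, ∫⁻ y, edist x y ∂μ ≠ ∞ := by
    by_contra! hx
    simp_rw [hx] at h
    simp at h
  obtain ⟨x, hx⟩ := hfin
  have hint : Integrable (id : X → X) μ := by
    refine ⟨aestronglyMeasurable_id, ?_⟩
    rw [hasFiniteIntegral_iff_enorm]
    calc ∫⁻ y, ‖id y‖ₑ ∂μ ≤ ∫⁻ y, (‖x‖ₑ + edist x y) ∂μ := lintegral_mono fun y => by
          rw [edist_eq_enorm_sub, id]
          calc ‖y‖ₑ = ‖x - (x - y)‖ₑ := by rw [sub_sub_cancel]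
            _ ≤ _ := enorm_sub_le
      _ = ‖x‖ₑ + ∫⁻ y, edist x y ∂μ := by rw [lintegral_add_left measurable_const]; simp
      _ < ∞ := by
          rw [ENNReal.add_lt_top]; exact ⟨enorm_lt_top, lt_top_iff_ne_top.2 hx⟩
  obtain ⟨T, hT, -⟩ := (memLp_one_iff_integrable.2 hint).exists_simpleFunc_eLpNorm_sub_lt
    ENNReal.one_ne_top hδ
  refine ⟨T, ?_⟩
  rwa [eLpNorm_one_eq_lintegral_enorm] at hT

theorem lintegral_lintegral_add_add {X : Type*} [MeasurableSpace X] {μ : Measure X}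
    [IsProbabilityMeasure μ] (A : X → X → ℝ≥0∞) {a : X → ℝ≥0∞} (ha : Measurable a) :
    ∫⁻ x, ∫⁻ y, (A x y + (a x + a y)) ∂μ ∂μ
      = ∫⁻ x, ∫⁻ y, A x y ∂μ ∂μ + 2 * ∫⁻ x, a x ∂μ := by
  have h1 : ∀ x, ∫⁻ y, (A x y + (a x + a y)) ∂μ
      = ∫⁻ y, A x y ∂μ + (a x + ∫⁻ y, a y ∂μ) := by
    intro x
    rw [lintegral_add_right _ (ha.const_add _), lintegral_add_left measurable_const]
    simp
  simp_rw [h1]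
  rw [lintegral_add_right _ (ha.add_const _), lintegral_add_right _ measurable_const]
  simp [two_mul]

/-- The map built for the law of a simple function `T` also works for `μ`: it is 1/2-Hölder
everywhere, so replacing `x` by `T x` changes squared distances by an error controlled by `‖x - T
x‖`, small in mean. -/
theorem exists_map_ellTwo_of_finite [NormedSpace ℝ X] [FiniteDimensional ℝ X] [BorelSpace X]
    (hX : 1 ≤ Module.finrank ℝ X) {μ : Measure X} [IsProbabilityMeasure μ]
    (h : ∫⁻ x, ∫⁻ y, edist x y ∂μ ∂μ ≠ ∞) :
    ∃ f : X → EllTwo,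
      (∀ x y, ‖f x - f y‖ ^ 2 ≤ 3072 * Real.log ((Module.finrank ℝ X : ℝ) + 1) * ‖x - y‖) ∧
      ∫⁻ x, ∫⁻ y, edist x y ∂μ ∂μ ≤ 25 * ∫⁻ x, ∫⁻ y, edist (f x) (f y) ^ 2 ∂μ ∂μ := by
  have : ProperSpace X := FiniteDimensional.proper ℝ X
  set L := 3072 * Real.log ((Module.finrank ℝ X : ℝ) + 1) with hL
  have hL0 : 0 ≤ L := mul_nonneg (by norm_num) (Real.log_nonneg (by simp))
  set I := ∫⁻ x, ∫⁻ y, edist x y ∂μ ∂μ with hI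
  rcases eq_or_ne I 0 with hI0 | hI0
  · refine ⟨fun _ => 0, fun x y => ?_, ?_⟩
    · simp only [sub_zero, norm_zero, ne_eq, OfNat.ofNat_ne_zero, not_false_eq_true, zero_pow]
      positivity
    · rw [hI0]; exact zero_le
  set r := I.toReal with hr
  have hr0 : 0 < r := ENNReal.toReal_pos hI0 h
  have hIr : I = ENNReal.ofReal r := (ENNReal.ofReal_toReal h).symm
  -- Chosen so that `r ≤ J + 2 δ` and `J / 2 ≤ 3 K + 6 L δ` give `r ≤ 6 K + r / 2`, which is more
  -- than the 25 requires.
  set δ := r / (24 * L + 16) with hδ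
  have hδ0 : 0 < δ := by positivity
  have hδr : δ * (24 * L + 16) = r := div_mul_cancel₀ _ (by positivity)
  obtain ⟨T, hT⟩ := exists_simpleFunc_lintegral_lt h (δ := ENNReal.ofReal δ) (by simpa using hδ0)
  set a : X → ℝ≥0∞ := fun x => ‖x - T x‖ₑ with ha
  have ham : Measurable a := (measurable_id.sub T.measurable).enorm
  set m : X → ℝ := fun x => μ.real (T ⁻¹' {x}) with hm
  set J := ∑ x ∈ T.range, ∑ y ∈ T.range, m x * m y * ‖x - y‖ with hJ
  have hJ0 : 0 ≤ J := Finset.sum_nonneg fun x _ => Finset.sum_nonneg fun y _ =>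
    mul_nonneg (mul_nonneg measureReal_nonneg measureReal_nonneg) (norm_nonneg _)
  have hIJ : r ≤ J + 2 * δ := by
    have h1 : I ≤ ENNReal.ofReal J + 2 * ENNReal.ofReal δ := by
      calc I ≤ ∫⁻ x, ∫⁻ y, (ENNReal.ofReal ‖T x - T y‖ + (a x + a y)) ∂μ ∂μ := by
            refine lintegral_mono fun x => lintegral_mono fun y => ?_
            rw [ofReal_norm, edist_eq_enorm_sub]
            have e : x - y = (T x - T y) + ((x - T x) - (y - T y)) := by abel
            rw [e]
            exact (enorm_add_le _ _).trans (by gcongr; exact enorm_sub_le)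
        _ = ENNReal.ofReal J + 2 * ∫⁻ x, a x ∂μ := by
            rw [lintegral_lintegral_add_add _ ham,
              T.lintegral_lintegral_ofReal μ (h := fun x y => ‖x - y‖) fun _ _ => norm_nonneg _]
        _ ≤ _ := by gcongr
    rw [hIr, ← ENNReal.ofReal_ofNat 2, ← ENNReal.ofReal_mul zero_le_two,
      ← ENNReal.ofReal_add hJ0 (by positivity)] at h1
    exact (ENNReal.ofReal_le_ofReal_iff (by positivity)).1 h1
  have hJpos : 0 < J := by nlinarith
  have hm1 : ∑ x ∈ T.range, m x = 1 := by
    have := T.lintegral_comp_eq_sum μ fun _ => 1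
    simp only [lintegral_const, measure_univ, mul_one, one_mul] at this
    have h2 := congrArg ENNReal.toReal this
    rw [ENNReal.toReal_sum fun x _ => measure_ne_top μ _] at h2
    simpa [hm, Measure.real] using h2.symm
  -- Duality needs a target strictly below `J`; `J / 2` is one because `J > 0`.
  obtain ⟨f, hf1, hf2⟩ := exists_euclidean_of_weights hX (s := T.range) (m := m) (S := J / 2)
    (fun _ => measureReal_nonneg) (fun x hx => by
      have : T ⁻¹' {x} = ∅ := by
        rw [SimpleFunc.preimage_eq_empty_iff]; exact hx
      simp [hm, this]) hm1 (by linarith)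
  obtain ⟨e⟩ := nonempty_linearIsometry_ellTwo (EuclideanSpace ℝ (Fin T.range.card))
  have hnorm : ∀ x y, ‖e (f x) - e (f y)‖ = ‖f x - f y‖ := fun x y => by
    rw [← map_sub, e.norm_map]
  refine ⟨fun x => e (f x), fun x y => by rw [hnorm]; exact hf1 x y, ?_⟩
  set K := ∫⁻ x, ∫⁻ y, edist (e (f x)) (e (f y)) ^ 2 ∂μ ∂μ with hK
  have hedist : ∀ x y, edist (e (f x)) (e (f y)) ^ 2 = ENNReal.ofReal (‖f x - f y‖ ^ 2) := by
    intro x y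
    rw [edist_dist, dist_eq_norm, hnorm, ENNReal.ofReal_pow (norm_nonneg _)]
  have hpt : ∀ x y, ‖f (T x) - f (T y)‖ ^ 2
      ≤ 3 * ‖f x - f y‖ ^ 2 + (3 * L * ‖x - T x‖ + 3 * L * ‖y - T y‖) := by
    intro x y
    have h1 := hf1 x (T x)
    have h2 := hf1 y (T y)
    have h3 : ‖f (T x) - f (T y)‖ ≤ ‖f x - f y‖ + ‖f x - f (T x)‖ + ‖f y - f (T y)‖ := by
      have e : f (T x) - f (T y) = (f x - f y) - (f x - f (T x)) + (f y - f (T y)) := by abel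
      rw [e]
      exact (norm_add_le _ _).trans (by gcongr; exact norm_sub_le _ _)
    have h4 := pow_le_pow_left₀ (norm_nonneg _) h3 2
    nlinarith [sq_nonneg (‖f x - f y‖ - ‖f x - f (T x)‖),
      sq_nonneg (‖f x - f y‖ - ‖f y - f (T y)‖), sq_nonneg (‖f x - f (T x)‖ - ‖f y - f (T y)‖)]
  have hJK : ENNReal.ofReal (J / 2) ≤ 3 * K + 2 * ENNReal.ofReal (3 * L * δ) := by
    calc ENNReal.ofReal (J / 2)
        ≤ ∫⁻ x, ∫⁻ y, ENNReal.ofReal (‖f (T x) - f (T y)‖ ^ 2) ∂μ ∂μ := by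
          rw [T.lintegral_lintegral_ofReal μ (h := fun x y => ‖f x - f y‖ ^ 2)
            fun _ _ => sq_nonneg _]
          exact ENNReal.ofReal_le_ofReal hf2
      _ ≤ ∫⁻ x, ∫⁻ y, (3 * edist (e (f x)) (e (f y)) ^ 2
            + (ENNReal.ofReal (3 * L) * a x + ENNReal.ofReal (3 * L) * a y)) ∂μ ∂μ := by
          refine lintegral_mono fun x => lintegral_mono fun y => ?_
          refine (ENNReal.ofReal_le_ofReal (hpt x y)).trans_eq ?_
          rw [hedist, ENNReal.ofReal_add (by positivity) (by positivity),
            ENNReal.ofReal_add (by positivity) (by positivity),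
            ENNReal.ofReal_mul (by positivity), ENNReal.ofReal_mul (by positivity),
            ENNReal.ofReal_mul (p := 3 * L) (by positivity), ofReal_norm,
            ofReal_norm, ENNReal.ofReal_ofNat]
      _ = 3 * K + 2 * (ENNReal.ofReal (3 * L) * ∫⁻ x, a x ∂μ) := by
          rw [lintegral_lintegral_add_add _ (ham.const_mul _), lintegral_const_mul _ ham]
          simp_rw [lintegral_const_mul' _ _ ENNReal.ofNat_ne_top]
          rfl
      _ ≤ _ := by
          rw [ENNReal.ofReal_mul (by positivity : 0 ≤ 3 * L)]
          gcongr
  rcases eq_or_ne K ∞ with hKtop | hKtop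
  · rw [hKtop]; simp
  have hKr : K = ENNReal.ofReal K.toReal := (ENNReal.ofReal_toReal hKtop).symm
  have hK0 : 0 ≤ K.toReal := ENNReal.toReal_nonneg
  rw [hKr, ← ENNReal.ofReal_ofNat 2, ← ENNReal.ofReal_ofNat 3, ← ENNReal.ofReal_mul (by norm_num),
    ← ENNReal.ofReal_mul (by norm_num), ← ENNReal.ofReal_add (by positivity) (by positivity),
    ENNReal.ofReal_le_ofReal_iff (by positivity)] at hJK
  rw [hIr, hKr, ← ENNReal.ofReal_ofNat 25, ← ENNReal.ofReal_mul (by norm_num)]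
  refine ENNReal.ofReal_le_ofReal ?_
  change J / 2 ≤ 3 * K.toReal + 2 * (3 * L * δ) at hJK
  change r ≤ 25 * K.toReal
  nlinarith

/-- When the double integral is infinite, `√‖x‖` placed in one coordinate has infinite quadratic
average, and its Hölder constant 1 is below `3072 log (n + 1)`. -/
theorem exists_map_ellTwo [NormedSpace ℝ X] [FiniteDimensional ℝ X] [BorelSpace X]
    (hX : 1 ≤ Module.finrank ℝ X) (μ : Measure X) [IsProbabilityMeasure μ] :
    ∃ f : X → EllTwo,
      (∀ x y, ‖f x - f y‖ ^ 2 ≤ 3072 * Real.log ((Module.finrank ℝ X : ℝ) + 1) * ‖x - y‖) ∧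
      ∫⁻ x, ∫⁻ y, edist x y ∂μ ∂μ ≤ 25 * ∫⁻ x, ∫⁻ y, edist (f x) (f y) ^ 2 ∂μ ∂μ := by
  rcases eq_or_ne (∫⁻ x, ∫⁻ y, edist x y ∂μ ∂μ) ∞ with h | h
  swap
  · exact exists_map_ellTwo_of_finite hX h
  have hnorm : ∀ x y : X, ‖(lp.single 2 0 (Real.sqrt ‖x‖) : EllTwo)
      - lp.single 2 0 (Real.sqrt ‖y‖)‖ ^ 2 = (Real.sqrt ‖x‖ - Real.sqrt ‖y‖) ^ 2 := by
    intro x y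
    rw [← lp.single_sub, lp.norm_single (by norm_num), Real.norm_eq_abs, sq_abs]
  refine ⟨fun x => lp.single 2 0 (Real.sqrt ‖x‖), fun x y => ?_, ?_⟩
  · rw [hnorm]
    have hL : 1 ≤ 3072 * Real.log ((Module.finrank ℝ X : ℝ) + 1) := by
      have : (1 : ℝ) ≤ Module.finrank ℝ X := by exact_mod_cast hX
      have := Real.log_le_log zero_lt_two (by linarith : (2 : ℝ) ≤ Module.finrank ℝ X + 1)
      linarith [Real.log_two_gt_d9]
    have h1 : (Real.sqrt ‖x‖ - Real.sqrt ‖y‖) ^ 2 ≤ ‖x - y‖ := by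
      have hx := Real.sq_sqrt (norm_nonneg x)
      have hy := Real.sq_sqrt (norm_nonneg y)
      have hx0 := Real.sqrt_nonneg ‖x‖
      have hy0 := Real.sqrt_nonneg ‖y‖
      have hxy := abs_le.1 (abs_norm_sub_norm_le x y)
      rcases le_total (Real.sqrt ‖x‖) (Real.sqrt ‖y‖) with hle | hle <;> nlinarith
    nlinarith [norm_nonneg (x - y)]
  · have e : ∀ x y : X, edist (lp.single 2 0 (Real.sqrt ‖x‖) : EllTwo)
        (lp.single 2 0 (Real.sqrt ‖y‖)) ^ 2
        = ENNReal.ofReal ((Real.sqrt ‖x‖ - Real.sqrt ‖y‖) ^ 2) := by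
      intro x y
      rw [edist_dist, dist_eq_norm, ← ENNReal.ofReal_pow (norm_nonneg _), hnorm]
    simp_rw [e]
    rw [lintegral_sqrt_norm_sub_sq_eq_top h]
    simp

end Measure

/-! ### Conclusion. -/

theorem theorem1 :
    ∃ C : ℝ, 0 < C ∧
      ∀ (X : Type*) [NormedAddCommGroup X] [NormedSpace ℝ X] [FiniteDimensional ℝ X],
        EmbedsWithAverageDistortion (HalfSnowflake X) EllTwo 2
          (C * Real.sqrt (Real.log ((Module.finrank ℝ X : ℝ) + 1))) := by
  -- The scale is `σ = 1/5`, which absorbs the factor 25 in the averages; the 5 here compensates for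
  -- it in the Lipschitz bound.
  refine ⟨5 * Real.sqrt 3072, by positivity, ?_⟩
  intro X _ _ _ _ _ μ _
  -- In dimension 0 the allowed distortion is 0, and a constant map works because the space is a
  -- point.
  rcases Nat.eq_zero_or_pos (Module.finrank ℝ X) with h0 | hX
  · have : Subsingleton X := Module.finrank_zero_iff.1 h0
    have : Subsingleton (HalfSnowflake X) := Metric.Snowflaking.ofSnowflaking.subsingleton
    refine ⟨1, one_pos, fun _ => 0, fun x y => ?_, ?_⟩
    · rw [Subsingleton.elim x y]; simp
    · have e : ∀ x y : HalfSnowflake X, edist x y ^ (2 : ℝ) = 0 := fun x y => by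
        rw [Subsingleton.elim x y]; simp
      simp [e]
  borelize X
  let ψ : HalfSnowflake X ≃ᵐ X :=
    (Metric.Snowflaking.homeomorph (X := X) (α := 1 / 2)).toMeasurableEquiv
  have : IsProbabilityMeasure (μ.map ψ) :=
    Measure.isProbabilityMeasure_map ψ.measurable.aemeasurable
  obtain ⟨f, hf1, hf2⟩ := exists_map_ellTwo hX (μ.map ψ)
  simp_rw [lintegral_map_equiv] at hf2
  set l := Real.log ((Module.finrank ℝ X : ℝ) + 1) with hl
  refine ⟨1 / 5, by norm_num, fun x => f (ψ x), fun x y => ?_, ?_⟩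
  · have hd : dist x y = Real.sqrt ‖ψ x - ψ y‖ := by
      rw [← dist_eq_norm, Real.sqrt_eq_rpow]
      rfl
    rw [hd, dist_eq_norm]
    refine (Real.le_sqrt_of_sq_le (hf1 _ _)).trans_eq ?_
    rw [Real.sqrt_mul' _ (norm_nonneg _), Real.sqrt_mul (by norm_num)]
    ring
  · have hd : ∀ x y : HalfSnowflake X, edist x y ^ (2 : ℝ) = edist (ψ x) (ψ y) := by
      intro x y
      have h : edist x y = edist (ψ x) (ψ y) ^ (1 / 2 : ℝ) := Metric.Snowflaking.edist_def x y
      rw [h, ← ENNReal.rpow_mul]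
      norm_num
    simp_rw [hd, ENNReal.rpow_ofNat]
    have h5 : ENNReal.ofReal (1 / 5) ^ 2 * 25 = 1 := by
      rw [← ENNReal.ofReal_pow (by norm_num), ← ENNReal.ofReal_ofNat 25,
        ← ENNReal.ofReal_mul (by norm_num)]
      norm_num
    calc _ ≤ ENNReal.ofReal (1 / 5) ^ 2
          * (25 * ∫⁻ x, ∫⁻ y, edist (f (ψ x)) (f (ψ y)) ^ 2 ∂μ ∂μ) := by gcongr
      _ = _ := by rw [← mul_assoc, h5, one_mul]
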